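/- Let $d\ge 1$, let $p_0:\mathbb R^d\to[0,\infty)$ be a probability density with respect to Lebesgue measure, and write $\widehat{p_0}(s)=\int_{\mathbb R^d}e^{i s^\top y}p_0(y)\,dy$. Assume that $p_0$ is upper-supersmooth of order $\alpha>0$, that is, for some constants $K$ and $C_1>0$, $$|\widehat{p_0}(s)|\le K\exp\Big(-C_1\sum_{j=1}^d|s_j|^\alpha\Big)\qquad\text{for all } s\in\mathbb R^d .$$ Let $\mathcal X\subset\mathbb R^d$ be a bounded set contained in the closure of its interior (for instance a bounded open set or a closed ball), and assume that $p_0$ is continuously differentiable on $\mathcal X$. Let $X_1,X_2,\dots$ be i.i.d. random vectors with density $p_0$, $X_i=(X_{i1},\dots,X_{id})$, and for $R>0$ let $$\widehat f_{n,R}(x)=\frac1{n\pi^d}\sum_{i=1}^n\prod_{j=1}^d\frac{\sin(R(x_j-X_{ij}))}{x_j-X_{ij}}$$ be the Fourier density estimator (a factor is read as $R$ when $x_j=X_{ij}$). Let $C$ be any constant with $C>\frac1{2C_1}$; if $1-\alpha<d/2$, then $C=\frac1{2C_1}$ is allowed as well. For $n\ge 2$ let $R=R_n>0$ be given by $R^\alpha=C\log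 n$. Then for every $x\in\mathcal X$, as $n\to\infty$: (1) $\displaystyle \sqrt{\frac{n}{R^d}}\,\big(\widehat f_{n,R}(x)-p_0(x)\big)\xrightarrow{\;d\;}\mathcal N\Big(0,\frac{p_0(x)}{\pi^d}\Big)$, where $\mathcal N(0,0)$ is the point mass at $0$. (2) If moreover $p_0(x)>0$, then for every $\tau\in(0,1)$, with $z_{1-\tau/2}$ the $(1-\tau/2)$-quantile of $\mathcal N(0,1)$, each of the intervals $$\widehat f_{n,R}(x)\pm z_{1-\tau/2}\sqrt{\frac{R^d\,p_0(x)}{n\pi^d}},\qquad \widehat f_{n,R}(x)\pm z_{1-\tau/2}\sqrt{\frac{R^d\max\{\widehat f_{n,R}(x),0\}}{n\pi^d}}$$ contains $p_0(x)$ with probability tending to $1-\tau$. -/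

import Mathlib

open MeasureTheory ProbabilityTheory Filter Topology

noncomputable section

/-- `p` is a probability density on `ℝ^d` with respect to Lebesgue measure. -/
structure IsProbDensity {d : ℕ} (p : EuclideanSpace ℝ (Fin d) → ℝ) : Prop where
  measurable : Measurable p
  nonneg : ∀ x, 0 ≤ p x
  integrable : Integrable p
  integral_eq_one : ∫ x, p x = 1

/-- The Fourier transform `s ↦ ∫ exp (i sᵀx) p(x) dx` of `p`, in the angular-frequency
normalisation used in probability theory. -/
def densityFourier {d : ℕ} (p : EuclideanSpace ℝ (Fin d) → ℝ)
    (s : EuclideanSpace ℝ (Fin d)) : ℂ :=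
  ∫ x : EuclideanSpace ℝ (Fin d),
    Complex.exp (Complex.I * ((∑ j, s j * x j : ℝ) : ℂ)) * ((p x : ℝ) : ℂ)

/-- The upper-supersmoothness inequality of order `α` with the constants `K` and `C₁ > 0`:
`|p̂(s)| ≤ K exp (-C₁ ∑ⱼ |sⱼ|^α)` for all `s`. The density `p` is upper-supersmooth of order `α`
when this holds for some `K` and some `C₁ > 0`. -/
def UpperSupersmoothWith {d : ℕ} (p : EuclideanSpace ℝ (Fin d) → ℝ) (α K C₁ : ℝ) : Prop :=
  0 < C₁ ∧ ∀ s : EuclideanSpace ℝ (Fin d),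
    ‖densityFourier p s‖ ≤ K * Real.exp (-C₁ * ∑ j, |s j| ^ α)

/-- The one-dimensional Fourier kernel `sin (R u) / u`, with its continuous value `R` at `u = 0`. -/
def fourierKernel (R u : ℝ) : ℝ :=
  if u = 0 then R else Real.sin (R * u) / u

/-- The Fourier density estimator at `x` with radius `R`, from the sample `X₀, …, Xₙ₋₁`:
`(1 / (n π^d)) ∑ᵢ ∏ⱼ sin (R (xⱼ - Xᵢⱼ)) / (xⱼ - Xᵢⱼ)`. -/
def fourierEstimator {d : ℕ} {Ω : Type*} (X : ℕ → Ω → EuclideanSpace ℝ (Fin d))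
    (n : ℕ) (R : ℝ) (x : EuclideanSpace ℝ (Fin d)) (ω : Ω) : ℝ :=
  1 / ((n : ℝ) * Real.pi ^ d) *
    ∑ i ∈ Finset.range n, ∏ j, fourierKernel R (x j - X i ω j)

/-- The interval `m ± z √(R^d v / (n π^d))`, with centre `m`, critical value `z`
and `v` standing for the value of the density. -/
def fourierInterval (d n : ℕ) (R z m v : ℝ) : Set ℝ :=
  Set.Icc (m - z * Real.sqrt (R ^ d * v / ((n : ℝ) * Real.pi ^ d)))
    (m + z * Real.sqrt (R ^ d * v / ((n : ℝ) * Real.pi ^ d)))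

end

/-! The normalised error splits into a centred sum of i.i.d. terms and a deterministic bias, both
computed on the Fourier side. The product kernel is, up to the factor `2 ^ (-d)`, the Fourier
transform of the indicator of the cube `(-R, R)^d` (`prod_fourierKernel_eq`).

Bias: the mean of the estimator is the inversion integral of `p̂` truncated to the cube, so the bias
is the missing tail (`norm_mean_sub_eq`). Supersmoothness bounds it by a constant times `∫_R^∞ exp
(-C₁ u^α) du`, which is of order `R^(1-α) exp (-C₁ R^α)`. Since `log n = R^α / C`, the scaling `√(n
/ R^d)` equals `exp (R^α / (2C)) R^(-d/2)`. The product vanishes when `1 / (2C) < C₁`, and also in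
the case of equality if `1 - α < d/2`.

Variance: the second moment of the kernel is a double integral of `p̂ (s + t)` over two cubes. As
`p̂` is integrable, dividing by `R^d` leaves in the limit a multiple of the full inversion integral
(`tendsto_integral_openCube_add`), that is `π^d p(x)`. The squared mean stays bounded and disappears
after this division.

Normality: the summands are bounded by a multiple of `R^(d/2) = o(√n)`, so a triangular central
limit theorem for bounded variables applies. Coverage follows from the portmanteau theorem and
Slutsky, since the estimator is `p(x)` plus a vanishing multiple of the normalised error. -/

/-! ### Central limit theorem for bounded triangular arrays. -/

/-- Third-order Taylor estimate for `u ↦ exp (iu)`. -/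
lemma norm_exp_mul_I_sub_taylor_le {u : ℝ} (hu : |u| ≤ 1) :
    ‖Complex.exp (u * Complex.I) - 1 - u * Complex.I + (u : ℂ) ^ 2 / 2‖ ≤ |u| ^ 3 := by
  have hn : ‖(u * Complex.I : ℂ)‖ = |u| := by simp
  have h := Complex.exp_bound (x := u * Complex.I) (by rw [hn]; exact hu) (n := 3) (by norm_num)
  rw [hn] at h
  have e : ∑ m ∈ Finset.range 3, (u * Complex.I : ℂ) ^ m / (m.factorial : ℂ)
      = 1 + u * Complex.I - (u : ℂ) ^ 2 / 2 := by
    simp [Finset.sum_range_succ, mul_pow, Nat.factorial]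
    ring
  rw [e] at h
  calc _ = ‖Complex.exp (u * Complex.I) - (1 + u * Complex.I - (u : ℂ) ^ 2 / 2)‖ := by
        congr 1; ring
    _ ≤ _ := h
    _ ≤ |u| ^ 3 * 1 := by
        gcongr
        norm_num [Nat.factorial]
    _ = _ := mul_one _

/-- The characteristic functions of a centred, uniformly negligible triangular array with
convergent variances: `(𝔼 exp (i t fₙ / √n)) ^ n → exp (- v t² / 2)`. -/
lemma tendsto_pow_integral_exp_mul_I {E : Type*} [MeasurableSpace E] {μ : Measure E}
    [IsProbabilityMeasure μ] {f : ℕ → E → ℝ} (hf : ∀ n, Measurable (f n)) {B : ℕ → ℝ}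
    (hB : ∀ n y, |f n y| ≤ B n) (hB0 : Tendsto (fun n : ℕ => B n / Real.sqrt n) atTop (𝓝 0))
    (h0 : ∀ n, ∫ y, f n y ∂μ = 0) {v : ℝ}
    (h2 : Tendsto (fun n => ∫ y, f n y ^ 2 ∂μ) atTop (𝓝 v)) (t : ℝ) :
    Tendsto (fun n : ℕ => (∫ y, Complex.exp (((t / Real.sqrt n * f n y : ℝ) : ℂ) * Complex.I) ∂μ) ^ n)
      atTop (𝓝 (Complex.exp (-((v : ℂ) * t ^ 2 / 2)))) := by
  set φ : ℕ → ℂ := fun n => ∫ y, Complex.exp (((t / Real.sqrt n * f n y : ℝ) : ℂ) * Complex.I) ∂μ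
  have hint : ∀ n, Integrable (f n) μ := fun n =>
    Integrable.of_bound (hf n).aestronglyMeasurable (B n) (.of_forall (hB n))
  have hint2 : ∀ n, Integrable (fun y => f n y ^ 2) μ := fun n =>
    Integrable.of_bound ((hf n).pow_const 2).aestronglyMeasurable (B n ^ 2) (.of_forall fun y => by
      rw [Real.norm_eq_abs, abs_pow]; exact pow_le_pow_left₀ (abs_nonneg _) (hB n y) 2)
  -- By `(1 + zₙ / n) ^ n → exp z` whenever `zₙ → z`, it suffices to find the limit of `n (φ n -
  -- 1)`.
  have key : Tendsto (fun n : ℕ => (n : ℂ) * (φ n - 1)) atTop (𝓝 (-((v : ℂ) * t ^ 2 / 2))) := by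
    have hmain : Tendsto (fun n => -(((∫ y, f n y ^ 2 ∂μ : ℝ) : ℂ) * t ^ 2 / 2)) atTop
        (𝓝 (-((v : ℂ) * t ^ 2 / 2))) := by
      have := (Complex.continuous_ofReal.tendsto v).comp h2
      exact ((this.mul_const _).div_const _).neg
    have hrest : Tendsto (fun n : ℕ => (n : ℂ) * (φ n - 1) -
        -(((∫ y, f n y ^ 2 ∂μ : ℝ) : ℂ) * t ^ 2 / 2)) atTop (𝓝 0) := by
      have hbound : Tendsto (fun n : ℕ => |t| ^ 3 * (B n / Real.sqrt n) * ∫ y, f n y ^ 2 ∂μ)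
          atTop (𝓝 0) := by
        simpa using (hB0.const_mul (|t| ^ 3)).mul h2
      refine squeeze_zero_norm' ?_ hbound
      have hsmall : ∀ᶠ n : ℕ in atTop, |t| * (B n / Real.sqrt n) < 1 := by
        have : Tendsto (fun n : ℕ => |t| * (B n / Real.sqrt n)) atTop (𝓝 0) := by
          simpa using hB0.const_mul |t|
        exact this.eventually_lt_const one_pos
      filter_upwards [hsmall, eventually_gt_atTop 0] with n hn hn0
      have hn0' : (0 : ℝ) < n := by exact_mod_cast hn0
      have hs : 0 < Real.sqrt n := Real.sqrt_pos.2 hn0'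
      have hss : Real.sqrt n ^ 2 = n := Real.sq_sqrt hn0'.le
      set u : E → ℝ := fun y => t / Real.sqrt n * f n y with hu
      have hule : ∀ y, |u y| ≤ |t| * (B n / Real.sqrt n) := fun y => by
        rw [hu]; simp only [abs_mul, abs_div, abs_of_pos hs]
        calc _ = |t| * (|f n y| / Real.sqrt n) := by ring
          _ ≤ _ := by gcongr; exact hB n y
      have hui : Integrable u μ := (hint n).const_mul _
      have hu2 : ∀ y, u y ^ 2 = t ^ 2 / n * f n y ^ 2 := fun y => by
        simp only [hu, mul_pow, div_pow, hss]
      have hu2i : Integrable (fun y => u y ^ 2) μ := by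
        simp_rw [hu2]; exact (hint2 n).const_mul _
      have hei : Integrable (fun y => Complex.exp ((u y : ℂ) * Complex.I)) μ :=
        Integrable.of_bound (by fun_prop) 1 (.of_forall fun y => by
          rw [Complex.norm_exp_ofReal_mul_I])
      have e1 : ∫ y, (Complex.exp ((u y : ℂ) * Complex.I) - 1 - u y * Complex.I
          + (u y : ℂ) ^ 2 / 2) ∂μ = (φ n - 1) + ((t ^ 2 / n * ∫ y, f n y ^ 2 ∂μ : ℝ) : ℂ) / 2 := by
        have i1 : Integrable (fun y => (u y : ℂ) * Complex.I) μ := hui.ofReal.mul_const _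
        have i2 : Integrable (fun y => (u y : ℂ) ^ 2 / 2) μ := by
          have := (hu2i.ofReal (𝕜 := ℂ)).div_const 2
          simpa using this
        have i3 : Integrable (fun y => Complex.exp ((u y : ℂ) * Complex.I) - 1) μ :=
          hei.sub (integrable_const _)
        have i4 : Integrable (fun y => Complex.exp ((u y : ℂ) * Complex.I) - 1 - u y * Complex.I) μ :=
          i3.sub i1
        rw [integral_add i4 i2, integral_sub i3 i1, integral_sub hei (integrable_const _),
          integral_mul_const, integral_div]
        have a1 : ∫ y, (u y : ℂ) ∂μ = 0 := by
          rw [integral_complex_ofReal, hu, integral_const_mul, h0]; simp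
        have a2 : ∫ y, (u y : ℂ) ^ 2 ∂μ = ((t ^ 2 / n * ∫ y, f n y ^ 2 ∂μ : ℝ) : ℂ) := by
          rw [← integral_const_mul, ← integral_complex_ofReal]
          congr 1 with y
          rw [← hu2]; push_cast; rfl
        rw [a1, a2]
        simp [φ, hu]
      have e2 : (n : ℂ) * (φ n - 1) - -(((∫ y, f n y ^ 2 ∂μ : ℝ) : ℂ) * t ^ 2 / 2)
          = n * ∫ y, (Complex.exp ((u y : ℂ) * Complex.I) - 1 - u y * Complex.I
          + (u y : ℂ) ^ 2 / 2) ∂μ := by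
        rw [e1]; push_cast
        have : (n : ℂ) ≠ 0 := by exact_mod_cast hn0.ne'
        field_simp
        ring
      rw [e2, norm_mul]
      -- One factor of `|u|³` is replaced by its uniform bound `|t| B n / √n`; the remaining `u²`,
      -- integrated and multiplied by `n`, is `t²` times the second moment, which stays bounded.
      have e3 : ‖∫ y, (Complex.exp ((u y : ℂ) * Complex.I) - 1 - u y * Complex.I
          + (u y : ℂ) ^ 2 / 2) ∂μ‖ ≤ ∫ y, |t| * (B n / Real.sqrt n) * u y ^ 2 ∂μ := by
        refine norm_integral_le_of_norm_le (hu2i.const_mul _) (.of_forall fun y => ?_)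
        refine (norm_exp_mul_I_sub_taylor_le ((hule y).trans hn.le)).trans ?_
        calc |u y| ^ 3 = |u y| * u y ^ 2 := by rw [← sq_abs]; ring
          _ ≤ _ := by gcongr; exact hule y
      rw [integral_const_mul] at e3
      calc _ ≤ (n : ℝ) * (|t| * (B n / Real.sqrt n) * ∫ y, u y ^ 2 ∂μ) := by
            simp only [Complex.norm_natCast]; gcongr
        _ = _ := by
            simp_rw [hu2]; rw [integral_const_mul, ← sq_abs t]; field_simp
    simpa using hrest.add hmain
  simpa only [add_sub_cancel] using Complex.tendsto_one_add_pow_exp_of_tendsto key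

/-- Central limit theorem for the row sums of a centred triangular array of bounded functions of
an i.i.d. sequence, up to a vanishing deterministic shift. -/
theorem tendstoInDistribution_inv_sqrt_mul_sum_triangular {E : Type*} [MeasurableSpace E]
    {μ : Measure E} [IsProbabilityMeasure μ] {Ω : Type*} [MeasurableSpace Ω] {P : Measure Ω}
    [IsProbabilityMeasure P] {X : ℕ → Ω → E} (hX : ∀ i, Measurable (X i)) (hindep : iIndepFun X P)
    (hlaw : ∀ i, P.map (X i) = μ) {f : ℕ → E → ℝ} (hf : ∀ n, Measurable (f n)) {B : ℕ → ℝ}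
    (hB : ∀ n y, |f n y| ≤ B n) (hB0 : Tendsto (fun n : ℕ => B n / Real.sqrt n) atTop (𝓝 0))
    (h0 : ∀ n, ∫ y, f n y ∂μ = 0) {v : ℝ} (hv : 0 ≤ v)
    (h2 : Tendsto (fun n => ∫ y, f n y ^ 2 ∂μ) atTop (𝓝 v))
    {b : ℕ → ℝ} (hb : Tendsto b atTop (𝓝 0)) :
    TendstoInDistribution
      (fun (n : ℕ) ω => (Real.sqrt n)⁻¹ * ∑ i ∈ Finset.range n, f n (X i ω) + b n) atTop
      (id : ℝ → ℝ) (fun _ => P) (gaussianReal 0 v.toNNReal) where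
  forall_aemeasurable n := by
    have : ∀ i, Measurable fun ω => f n (X i ω) := fun i => (hf n).comp (hX i)
    fun_prop
  tendsto := by
    have hm : ∀ n i, Measurable fun ω => f n (X i ω) := fun n i => (hf n).comp (hX i)
    refine ProbabilityMeasure.tendsto_iff_tendsto_charFun.2 fun t => ?_
    simp only [ProbabilityMeasure.coe_mk, Measure.map_id, charFun_gaussianReal]
    have hcf : ∀ n : ℕ, charFun (P.map fun ω =>
        (Real.sqrt n)⁻¹ * ∑ i ∈ Finset.range n, f n (X i ω) + b n) t
        = (∫ y, Complex.exp (((t / Real.sqrt n * f n y : ℝ) : ℂ) * Complex.I) ∂μ) ^ n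
          * Complex.exp ((b n * t : ℝ) * Complex.I) := by
      intro n
      have hsum : Measurable fun ω => (Real.sqrt n)⁻¹ * ∑ i ∈ Finset.range n, f n (X i ω) := by
        have := hm n
        fun_prop
      have hcomp : P.map (fun ω => (Real.sqrt n)⁻¹ * ∑ i ∈ Finset.range n, f n (X i ω) + b n)
          = (P.map fun ω => (Real.sqrt n)⁻¹ * ∑ i ∈ Finset.range n, f n (X i ω)).map
            (· + b n) := by
        rw [Measure.map_map (by fun_prop) hsum]; rfl
      have hind : iIndepFun (fun i ω => f n (X i ω)) P := hindep.comp (fun _ => f n) fun _ => hf n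
      rw [hcomp, charFun_map_add_const, charFun_map_mul_comp
        (Finset.aemeasurable_fun_sum _ fun i _ => (hm n i).aemeasurable),
        (hind.restrict _).charFun_map_fun_finsetSum_eq_prod (fun i _ => (hm n i).aemeasurable)]
      congr 1
      · rw [Finset.prod_apply, Finset.prod_congr rfl (g := fun _ => ∫ y,
          Complex.exp (((t / Real.sqrt n * f n y : ℝ) : ℂ) * Complex.I) ∂μ)]
        · simp
        intro i _
        have hc : P.map (fun ω => f n (X i ω)) = μ.map (f n) := by
          rw [← hlaw i, Measure.map_map (hf n) (hX i)]; rfl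
        rw [hc, charFun_apply_real, integral_map (hf n).aemeasurable (by fun_prop)]
        congr 1 with y
        congr 2
        push_cast
        ring
      · simp [mul_comm]
    simp_rw [hcf]
    have h1 := tendsto_pow_integral_exp_mul_I hf hB hB0 h0 h2 t
    have h3 : Tendsto (fun n => Complex.exp ((b n * t : ℝ) * Complex.I)) atTop (𝓝 1) := by
      have : Tendsto (fun n => b n * t) atTop (𝓝 0) := by simpa using hb.mul_const t
      have c : Continuous fun r : ℝ => Complex.exp (r * Complex.I) := by fun_prop
      simpa [Function.comp_def] using (c.tendsto 0).comp this
    have := h1.mul h3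
    rw [mul_one] at this
    convert this using 2
    simp [Real.coe_toNNReal _ hv]

/-! ### The product kernel and its moments on the Fourier side. -/

section

/-- The open cube `(-R, R)^d`. -/
def openCube (d : ℕ) (R : ℝ) : Set (EuclideanSpace ℝ (Fin d)) := {s | ∀ j, |s j| < R}

/-- The integrand `s ↦ exp (-i sᵀx) p̂(s)` of the Fourier inversion formula. -/
noncomputable def inversionIntegrand {d : ℕ} (p : EuclideanSpace ℝ (Fin d) → ℝ)
    (x s : EuclideanSpace ℝ (Fin d)) : ℂ :=
  Complex.exp (((-∑ j, s j * x j : ℝ) : ℂ) * Complex.I) * densityFourier p s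

variable {d : ℕ}

lemma integral_euclidean_prod {𝕜 : Type*} [RCLike 𝕜] (f : Fin d → ℝ → 𝕜) :
    ∫ s : EuclideanSpace ℝ (Fin d), ∏ j, f j (s j) = ∏ j, ∫ u, f j u := by
  rw [← integral_fintype_prod_volume_eq_prod f]
  exact (EuclideanSpace.volume_preserving_symm_measurableEquiv_toLp (Fin d)).integral_comp'
    (fun y : Fin d → ℝ => ∏ j, f j (y j))

lemma integrable_euclidean_prod {f : Fin d → ℝ → ℝ} (hf : ∀ j, Integrable (f j)) :
    Integrable fun s : EuclideanSpace ℝ (Fin d) => ∏ j, f j (s j) :=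
  ((EuclideanSpace.volume_preserving_symm_measurableEquiv_toLp (Fin d)).integrable_comp_emb
    (MeasurableEquiv.measurableEmbedding _)).2 (Integrable.fintype_prod hf)

lemma measurableSet_openCube (R : ℝ) : MeasurableSet (openCube d R) := by
  have : openCube d R = ⋂ j, {s | |s j| < R} := by ext; simp [openCube]
  rw [this]
  exact MeasurableSet.iInter fun j => measurableSet_lt (by fun_prop) (by fun_prop)

lemma volume_openCube (R : ℝ) : volume (openCube d R) = ENNReal.ofReal (2 * R) ^ d := by
  have h : openCube d R = (MeasurableEquiv.toLp 2 (Fin d → ℝ)).symm ⁻¹'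
      (Set.univ.pi fun _ => Set.Ioo (-R) R) := by
    ext s; simp [openCube, abs_lt]
  rw [h, (EuclideanSpace.volume_preserving_symm_measurableEquiv_toLp (Fin d)).measure_preimage
    (MeasurableSet.univ_pi fun _ => measurableSet_Ioo).nullMeasurableSet, volume_pi_pi]
  simp [two_mul]

instance isFiniteMeasure_restrict_openCube (R : ℝ) :
    IsFiniteMeasure ((volume : Measure (EuclideanSpace ℝ (Fin d))).restrict (openCube d R)) :=
  ⟨by rw [Measure.restrict_apply_univ, volume_openCube]; exact ENNReal.pow_lt_top ENNReal.ofReal_lt_top⟩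

open Pointwise in
lemma smul_openCube {R : ℝ} (hR : 0 < R) : R • openCube d 1 = openCube d R := by
  ext s
  rw [Set.mem_smul_set_iff_inv_smul_mem₀ hR.ne']
  simp only [openCube, Set.mem_ofPred_eq, PiLp.smul_apply, smul_eq_mul, abs_mul, abs_inv,
    abs_of_pos hR]
  exact forall_congr' fun j => by rw [inv_mul_lt_iff₀ hR, mul_one]

/-- `∫_{-R}^R exp (-isu) ds = 2 sin (Ru) / u`. -/
lemma integral_Ioo_exp_mul_I {R : ℝ} (hR : 0 < R) (u : ℝ) :
    ∫ s in Set.Ioo (-R) R, Complex.exp (((-(s * u) : ℝ) : ℂ) * Complex.I)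
      = 2 * (fourierKernel R u : ℂ) := by
  rw [← integral_Ioc_eq_integral_Ioo, ← intervalIntegral.integral_of_le (by linarith)]
  by_cases hu : u = 0
  · simp [fourierKernel, hu]; ring
  have hc : (-(u : ℂ) * Complex.I) ≠ 0 := by simp [hu]
  have : ∀ s : ℝ, Complex.exp (((-(s * u) : ℝ) : ℂ) * Complex.I)
      = Complex.exp ((-(u : ℂ) * Complex.I) * s) := fun s => by
    congr 1; push_cast; ring
  simp_rw [this]
  rw [integral_exp_mul_complex hc, fourierKernel, if_neg hu]
  have hu' : (u : ℂ) ≠ 0 := by exact_mod_cast hu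
  have e : (Complex.sin ((R : ℂ) * u)) = (Complex.exp (-(R * u) * Complex.I)
      - Complex.exp (R * u * Complex.I)) * Complex.I / 2 := rfl
  push_cast
  rw [e]
  have a1 : -(u : ℂ) * Complex.I * R = -(R * u) * Complex.I := by ring
  have a2 : -(u : ℂ) * Complex.I * -R = R * u * Complex.I := by ring
  rw [a1, a2]
  field_simp
  rw [Complex.I_sq]
  ring

/-- The product kernel is the Fourier transform of the indicator of a cube. -/
lemma prod_fourierKernel_eq {R : ℝ} (hR : 0 < R) (u : Fin d → ℝ) :
    ((∏ j, fourierKernel R (u j) : ℝ) : ℂ) = (1 / 2) ^ d *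
      ∫ s in openCube d R, Complex.exp (((-∑ j, s j * u j : ℝ) : ℂ) * Complex.I) := by
  have h1 : ∫ s in openCube d R, Complex.exp (((-∑ j, s j * u j : ℝ) : ℂ) * Complex.I)
      = ∫ s : EuclideanSpace ℝ (Fin d), ∏ j, (Set.Ioo (-R) R).indicator
        (fun r : ℝ => Complex.exp (((-(r * u j) : ℝ) : ℂ) * Complex.I)) (s j) := by
    rw [← integral_indicator (measurableSet_openCube R)]
    congr 1 with s
    by_cases hs : s ∈ openCube d R
    · rw [Set.indicator_of_mem hs, Finset.prod_congr rfl fun j _ =>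
        Set.indicator_of_mem (Set.mem_Ioo.2 (abs_lt.1 (hs j))) _, ← Complex.exp_sum]
      congr 1
      rw [← Finset.sum_mul]
      push_cast
      rw [Finset.sum_neg_distrib]
    · rw [Set.indicator_of_notMem hs]
      obtain ⟨j, hj⟩ : ∃ j, ¬ |s j| < R := by simpa [openCube] using hs
      exact (Finset.prod_eq_zero (Finset.mem_univ j)
        (Set.indicator_of_notMem (fun h => hj (abs_lt.2 (Set.mem_Ioo.1 h))) _)).symm
  rw [h1, integral_euclidean_prod]
  simp_rw [integral_indicator measurableSet_Ioo, integral_Ioo_exp_mul_I hR]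
  rw [Finset.prod_mul_distrib]
  simp

lemma abs_fourierKernel_le (R u : ℝ) : |fourierKernel R u| ≤ |R| := by
  unfold fourierKernel
  split_ifs with h
  · exact le_rfl
  · rw [abs_div, div_le_iff₀ (abs_pos.2 h), ← abs_mul]
    exact Real.abs_sin_le_abs

lemma measurable_fourierKernel (R : ℝ) : Measurable (fourierKernel R) := by
  unfold fourierKernel
  exact Measurable.ite (measurableSet_singleton 0) measurable_const (by fun_prop)

lemma abs_prod_fourierKernel_le (R : ℝ) (u : Fin d → ℝ) :
    |∏ j, fourierKernel R (u j)| ≤ |R| ^ d := by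
  rw [Finset.abs_prod]
  calc _ ≤ ∏ _j : Fin d, |R| :=
        Finset.prod_le_prod (fun _ _ => abs_nonneg _) fun j _ => abs_fourierKernel_le R _
    _ = _ := by simp

lemma measurable_prod_fourierKernel (R : ℝ) (x : EuclideanSpace ℝ (Fin d)) :
    Measurable fun y : EuclideanSpace ℝ (Fin d) => ∏ j, fourierKernel R (x j - y j) :=
  Finset.measurable_fun_prod _ fun j _ => (measurable_fourierKernel R).comp (by fun_prop)

variable {p : EuclideanSpace ℝ (Fin d) → ℝ}

lemma continuous_densityFourier (hp : Integrable p) : Continuous (densityFourier p) := by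
  unfold densityFourier
  have h1 : ∀ x : EuclideanSpace ℝ (Fin d), Continuous fun s : EuclideanSpace ℝ (Fin d) =>
      Complex.exp (Complex.I * ((∑ j, s j * x j : ℝ) : ℂ)) * ((p x : ℝ) : ℂ) := fun x => by fun_prop
  have h2 : ∀ s : EuclideanSpace ℝ (Fin d), Continuous fun x : EuclideanSpace ℝ (Fin d) =>
      Complex.exp (Complex.I * ((∑ j, s j * x j : ℝ) : ℂ)) := fun s => by fun_prop
  refine continuous_of_dominated (bound := fun x => ‖p x‖)
    (fun s => (h2 s).aestronglyMeasurable.mul hp.ofReal.aestronglyMeasurable)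
    (fun s => .of_forall fun x => ?_) hp.norm (.of_forall h1)
  rw [norm_mul, mul_comm Complex.I, Complex.norm_exp_ofReal_mul_I, one_mul, Complex.norm_real]

lemma continuous_inversionIntegrand (hp : Integrable p) (x : EuclideanSpace ℝ (Fin d)) :
    Continuous (inversionIntegrand p x) := by
  have := continuous_densityFourier hp
  unfold inversionIntegrand
  fun_prop

lemma norm_inversionIntegrand (x s : EuclideanSpace ℝ (Fin d)) :
    ‖inversionIntegrand p x s‖ = ‖densityFourier p s‖ := by
  rw [inversionIntegrand, norm_mul, Complex.norm_exp_ofReal_mul_I, one_mul]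

/-- Parseval-type identity: integrating a superposition of characters against `p`. -/
lemma integral_integral_exp_mul {S : Type*} [MeasurableSpace S] {ν : Measure S} [IsFiniteMeasure ν]
    (hp : Integrable p) {σ : S → EuclideanSpace ℝ (Fin d)} (hσ : Measurable σ)
    (x : EuclideanSpace ℝ (Fin d)) :
    ∫ y, (∫ s, Complex.exp (((-∑ j, σ s j * (x j - y j) : ℝ) : ℂ) * Complex.I) ∂ν) * (p y : ℂ)
      = ∫ s, inversionIntegrand p x (σ s) ∂ν := by
  simp_rw [← integral_mul_const]
  rw [integral_integral_swap]
  · congr 1 with s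
    rw [inversionIntegrand, densityFourier, ← integral_const_mul]
    congr 1 with y
    rw [← mul_assoc, ← Complex.exp_add]
    congr 2
    rw [mul_comm Complex.I, ← add_mul, ← Complex.ofReal_add]
    congr 2
    simp_rw [mul_sub, Finset.sum_sub_distrib]
    ring
  -- Fubini is justified because characters have modulus one, `p` is integrable and `ν` is finite.
  · have h1 : Integrable (fun z : EuclideanSpace ℝ (Fin d) × S => (p z.1 : ℂ) * (1 : ℂ))
        (volume.prod ν) := hp.ofReal.mul_prod (integrable_const (1 : ℂ))
    have hm : Measurable fun z : EuclideanSpace ℝ (Fin d) × S =>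
        Complex.exp (((-∑ j, σ z.2 j * (x j - z.1 j) : ℝ) : ℂ) * Complex.I) := by
      have h2 : ∀ j, Measurable fun z : EuclideanSpace ℝ (Fin d) × S => σ z.2 j := fun j => by
        have : Measurable fun z : EuclideanSpace ℝ (Fin d) × S => σ z.2 := hσ.comp measurable_snd
        fun_prop
      fun_prop
    refine h1.mono (hm.aestronglyMeasurable.mul (by simpa using h1.aestronglyMeasurable))
      (.of_forall fun z => ?_)
    simp only [Function.uncurry, norm_mul, Complex.norm_exp_ofReal_mul_I, one_mul, mul_one,
      le_refl]

/-- The mean of the product kernel in terms of the Fourier transform. -/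
lemma integral_prod_fourierKernel_mul (hp : Integrable p) {R : ℝ} (hR : 0 < R)
    (x : EuclideanSpace ℝ (Fin d)) :
    ((∫ y, (∏ j, fourierKernel R (x j - y j)) * p y : ℝ) : ℂ)
      = (1 / 2) ^ d * ∫ s in openCube d R, inversionIntegrand p x s := by
  have h := integral_integral_exp_mul (ν := volume.restrict (openCube d R)) hp measurable_id x
  simp only [id] at h
  rw [← h, ← integral_complex_ofReal,
    ← integral_const_mul]
  congr 1 with y
  rw [Complex.ofReal_mul, prod_fourierKernel_eq hR, mul_assoc]

/-- The second moment of the product kernel in terms of the Fourier transform. -/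
lemma integral_prod_fourierKernel_sq_mul (hp : Integrable p) {R : ℝ} (hR : 0 < R)
    (x : EuclideanSpace ℝ (Fin d)) :
    ((∫ y, (∏ j, fourierKernel R (x j - y j)) ^ 2 * p y : ℝ) : ℂ)
      = (1 / 4) ^ d * ∫ z : EuclideanSpace ℝ (Fin d) × EuclideanSpace ℝ (Fin d),
        inversionIntegrand p x (z.1 + z.2)
          ∂((volume.restrict (openCube d R)).prod (volume.restrict (openCube d R))) := by
  rw [← integral_integral_exp_mul (σ := fun z : EuclideanSpace ℝ (Fin d) ×
      EuclideanSpace ℝ (Fin d) => z.1 + z.2) hp (by fun_prop) x, ← integral_complex_ofReal,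
    ← integral_const_mul]
  congr 1 with y
  rw [Complex.ofReal_mul, Complex.ofReal_pow, prod_fourierKernel_eq hR, ← mul_assoc]
  congr 1
  have : ∀ z : EuclideanSpace ℝ (Fin d) × EuclideanSpace ℝ (Fin d),
      Complex.exp (((-∑ j, (z.1 + z.2) j * (x j - y j) : ℝ) : ℂ) * Complex.I)
      = Complex.exp (((-∑ j, z.1 j * (x j - y j) : ℝ) : ℂ) * Complex.I)
        * Complex.exp (((-∑ j, z.2 j * (x j - y j) : ℝ) : ℂ) * Complex.I) := fun z => by
    rw [← Complex.exp_add, ← add_mul, ← Complex.ofReal_add]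
    congr 3
    simp [add_mul, Finset.sum_add_distrib, add_comm]
  simp_rw [this]
  rw [integral_prod_mul (μ := volume.restrict (openCube d R)) (ν := volume.restrict (openCube d R))
    (fun s : EuclideanSpace ℝ (Fin d) =>
      Complex.exp (((-∑ j, s j * (x j - y j) : ℝ) : ℂ) * Complex.I))
    (fun s : EuclideanSpace ℝ (Fin d) =>
      Complex.exp (((-∑ j, s j * (x j - y j) : ℝ) : ℂ) * Complex.I)), mul_pow, ← pow_mul,
    mul_comm d 2, pow_mul]
  norm_num
  rw [sq]

open Pointwise in
/-- Averaging `g (s + t)` over a large cube recovers the integral of `g`. -/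
lemma tendsto_integral_openCube_add {g : EuclideanSpace ℝ (Fin d) → ℂ} (hg : Integrable g)
    (hgm : Measurable g) :
    Tendsto (fun R : ℝ => ((R ^ d : ℝ) : ℂ)⁻¹ *
      ∫ z : EuclideanSpace ℝ (Fin d) × EuclideanSpace ℝ (Fin d), g (z.1 + z.2)
          ∂((volume.restrict (openCube d R)).prod (volume.restrict (openCube d R))))
      atTop (𝓝 (2 ^ d * ∫ w, g w)) := by
  -- With `s = R • a` and `w = s + t`, the double integral is `R^d` times the integral over `a` in
  -- the unit cube of `Φ R a`: the prefactor cancels the Jacobian.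
  set Φ : ℝ → EuclideanSpace ℝ (Fin d) → ℂ := fun R a =>
    ∫ w, (openCube d R).indicator (fun _ => (1 : ℂ)) (w - R • a) * g w with hΦ
  have hind : ∀ R (w : EuclideanSpace ℝ (Fin d)),
      ‖(openCube d R).indicator (fun _ => (1 : ℂ)) w‖ ≤ 1 := fun R w => by
    by_cases h : w ∈ openCube d R <;> simp [h]
  have hbd : ∀ R (w v : EuclideanSpace ℝ (Fin d)),
      ‖(openCube d R).indicator (fun _ => (1 : ℂ)) v * g w‖ ≤ ‖g w‖ := fun R w v => by
    rw [norm_mul]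
    exact mul_le_of_le_one_left (norm_nonneg _) (hind R v)
  have hind_meas : ∀ R, Measurable ((openCube d R).indicator (fun _ => (1 : ℂ))) := fun R =>
    measurable_const.indicator (measurableSet_openCube R)
  have hint : ∀ R a, Integrable fun w =>
      (openCube d R).indicator (fun _ => (1 : ℂ)) (w - R • a) * g w := fun R a =>
    hg.mono (((hind_meas R).comp (by fun_prop)).mul hgm).aestronglyMeasurable
      (.of_forall fun w => hbd R w _)
  have hΦlim : ∀ a ∈ openCube d 1, Tendsto (fun R => Φ R a) atTop (𝓝 (∫ w, g w)) := by
    intro a ha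
    refine tendsto_integral_filter_of_dominated_convergence (fun w => ‖g w‖)
      (.of_forall fun R => (hint R a).aestronglyMeasurable)
      (.of_forall fun R => .of_forall fun w => hbd R w _) hg.norm (.of_forall fun w => ?_)
    refine tendsto_const_nhds.congr' ?_
    -- As `|a j| < 1` strictly, the cube of side `2R` centred at `R • a` eventually contains any
    -- fixed `w`.
    have : ∀ j, ∀ᶠ R : ℝ in atTop, |(w - R • a) j| < R := fun j => by
      have hj : 0 < 1 - |a j| := sub_pos.2 (ha j)
      filter_upwards [eventually_gt_atTop 0, eventually_gt_atTop (|w j| / (1 - |a j|))] with R h0 hR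
      rw [div_lt_iff₀ hj] at hR
      calc |(w - R • a) j| = |w j - R * a j| := by simp
        _ ≤ |w j| + |R * a j| := abs_sub _ _
        _ = |w j| + R * |a j| := by rw [abs_mul, abs_of_pos h0]
        _ < R := by linarith
    filter_upwards [eventually_all.2 this] with R hR
    rw [Set.indicator_of_mem (show w - R • a ∈ openCube d R from hR), one_mul]
  have hlim : Tendsto (fun R => ∫ a in openCube d 1, Φ R a) atTop
      (𝓝 (∫ _a in openCube d 1, ∫ w, g w)) := by
    refine tendsto_integral_filter_of_dominated_convergence (fun _ => ∫ w, ‖g w‖)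
      (.of_forall fun R => ?_) (.of_forall fun R => .of_forall fun a => ?_) (integrable_const _)
      ((ae_restrict_iff' (measurableSet_openCube 1)).2 (.of_forall fun a ha => hΦlim a ha))
    · have hm : Measurable fun z : EuclideanSpace ℝ (Fin d) × EuclideanSpace ℝ (Fin d) =>
          (openCube d R).indicator (fun _ => (1 : ℂ)) (z.2 - R • z.1) * g z.2 :=
        ((hind_meas R).comp (by fun_prop)).mul (hgm.comp measurable_snd)
      exact (hm.stronglyMeasurable.integral_prod_right').aestronglyMeasurable
    · exact norm_integral_le_of_norm_le hg.norm (.of_forall fun w => hbd R w _)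
  have hvol : (volume : Measure (EuclideanSpace ℝ (Fin d))).real (openCube d 1) = 2 ^ d := by
    rw [measureReal_def, volume_openCube]; simp
  rw [setIntegral_const, hvol, Complex.real_smul] at hlim
  push_cast at hlim
  refine hlim.congr' ?_
  filter_upwards [eventually_gt_atTop 0] with R hR
  have hgi : Integrable (fun z : EuclideanSpace ℝ (Fin d) × EuclideanSpace ℝ (Fin d) =>
      g (z.1 + z.2)) ((volume.restrict (openCube d R)).prod (volume.restrict (openCube d R))) := by
    refine (integrable_prod_iff (hgm.comp (by fun_prop)).aestronglyMeasurable).2 ⟨?_, ?_⟩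
    · exact .of_forall fun s => (hg.comp_add_left s).restrict
    · refine Integrable.of_bound ?_ (∫ w, ‖g w‖) (.of_forall fun s => ?_)
      · exact ((hgm.comp (by fun_prop : Measurable fun z : EuclideanSpace ℝ (Fin d) ×
          EuclideanSpace ℝ (Fin d) => z.1 + z.2)).norm.stronglyMeasurable.integral_prod_right'
          ).aestronglyMeasurable
      · rw [Real.norm_eq_abs, abs_of_nonneg (integral_nonneg fun _ => norm_nonneg _)]
        rw [← integral_add_left_eq_self (fun w => ‖g w‖) s]
        exact setIntegral_le_integral (hg.comp_add_left s).norm (.of_forall fun _ => norm_nonneg _)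
  rw [integral_prod _ hgi]
  have hΦ' : ∀ a, Φ R a = ∫ t in openCube d R, g (R • a + t) := fun a => by
    rw [hΦ, ← integral_indicator (measurableSet_openCube R),
      ← integral_sub_right_eq_self _ (R • a)]
    refine integral_congr_ae (.of_forall fun w => ?_)
    simp only
    by_cases h : w - R • a ∈ openCube d R <;> simp [h]
  simp_rw [hΦ']
  rw [Measure.setIntegral_comp_smul volume (fun s => ∫ t in openCube d R, g (s + t)) _ hR.ne',
    smul_openCube hR, finrank_euclideanSpace_fin, Complex.real_smul,
    abs_of_pos (inv_pos.2 (pow_pos hR d)), Complex.ofReal_inv]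

end

/-! ### Exponential tails and the mass of `p̂` outside a cube. -/

section

/-- A non-integrable function has Bochner integral `0`, whereas the Gamma-function formula for the
half line gives a positive value. -/
lemma integrable_exp_neg_mul_abs_rpow {α b : ℝ} (hα : 0 < α) (hb : 0 < b) :
    Integrable fun u : ℝ => Real.exp (-b * |u| ^ α) := by
  by_contra h
  have h1 := integral_comp_abs (f := fun u : ℝ => Real.exp (-b * u ^ α))
  rw [integral_undef h, integral_exp_neg_mul_rpow hα hb] at h1
  have : 0 < 2 * (b ^ (-1 / α) * Real.Gamma (1 / α + 1)) :=
    mul_pos two_pos (mul_pos (Real.rpow_pos_of_pos hb _) (Real.Gamma_pos_of_pos (by positivity)))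
  linarith

lemma integrableOn_Ioi_exp_neg_mul_rpow {α b R : ℝ} (hα : 0 < α) (hb : 0 < b) (hR : 0 ≤ R) :
    IntegrableOn (fun u : ℝ => Real.exp (-b * u ^ α)) (Set.Ioi R) := by
  refine (integrable_exp_neg_mul_abs_rpow hα hb).integrableOn.congr_fun (fun u hu => ?_)
    measurableSet_Ioi
  simp only [abs_of_pos (hR.trans_lt hu)]

/-- The tail `∫_R^∞ exp (-b u^α) du` is `o (R^β exp (-b R^α))` when `β > 1 - α`. -/
lemma tendsto_integral_Ioi_exp_neg_div {α b β : ℝ} (hα : 0 < α) (hb : 0 < b) (hβ : 1 - α < β) :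
    Tendsto (fun R : ℝ => (∫ u in Set.Ioi R, Real.exp (-b * u ^ α)) /
      (R ^ β * Real.exp (-b * R ^ α))) atTop (𝓝 0) := by
  have hi := integrableOn_Ioi_exp_neg_mul_rpow hα hb le_rfl
  have hc : Continuous fun u : ℝ => Real.exp (-b * u ^ α) := by
    have := Real.continuous_rpow_const hα.le
    fun_prop
  have hpow := tendsto_rpow_atTop hα
  have htail : ∀ R : ℝ, 0 ≤ R → (∫ u in Set.Ioi R, Real.exp (-b * u ^ α))
      = (∫ u in Set.Ioi 0, Real.exp (-b * u ^ α)) - ∫ u in (0 : ℝ)..R, Real.exp (-b * u ^ α) :=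
    fun R hR => by rw [← intervalIntegral.integral_Ioi_sub_Ioi hi hR]; ring
  -- Written as a constant minus an interval integral, the tail can be differentiated in `R`, as
  -- l'Hôpital's rule requires.
  refine Tendsto.congr' (f₁ := fun R : ℝ => ((∫ u in Set.Ioi 0, Real.exp (-b * u ^ α))
    - ∫ u in (0 : ℝ)..R, Real.exp (-b * u ^ α)) / (R ^ β * Real.exp (-b * R ^ α))) ?_ ?_
  · filter_upwards [eventually_ge_atTop 0] with R hR
    rw [htail R hR]
  -- The quotient of the derivatives is the reciprocal of this function. Its exponent is positive
  -- exactly because `β > 1 - α`.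
  have hden : Tendsto (fun R : ℝ => R ^ (β + α - 1) * (b * α - β * R ^ (-α))) atTop atTop := by
    refine (tendsto_rpow_atTop (by linarith)).atTop_mul_pos (C := b * α) (by positivity) ?_
    simpa using ((tendsto_rpow_neg_atTop hα).const_mul β).const_sub (b * α)
  refine HasDerivAt.lhopital_zero_atTop (f' := fun R => -Real.exp (-b * R ^ α))
    (g' := fun R => -(Real.exp (-b * R ^ α) * (R ^ (β + α - 1) * (b * α - β * R ^ (-α)))))
    (.of_forall fun R => ?_) ?_ ?_ ?_ ?_ ?_
  · simpa using (hc.integral_hasStrictDerivAt 0 R).hasDerivAt.const_sub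
      (∫ u in Set.Ioi 0, Real.exp (-b * u ^ α))
  · filter_upwards [eventually_gt_atTop 0] with R hR
    have h1 : HasDerivAt (fun R : ℝ => R ^ β) (β * R ^ (β - 1)) R :=
      Real.hasDerivAt_rpow_const (.inl hR.ne')
    have h2 : HasDerivAt (fun R : ℝ => Real.exp (-b * R ^ α))
        (Real.exp (-b * R ^ α) * (-b * (α * R ^ (α - 1)))) R :=
      ((Real.hasDerivAt_rpow_const (.inl hR.ne')).const_mul (-b)).exp
    refine (h1.mul h2).congr_deriv ?_
    have e1 : R ^ (β + α - 1) = R ^ β * R ^ (α - 1) := by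
      rw [← Real.rpow_add hR]; congr 1; ring
    have e2 : R ^ (β - 1) = R ^ β * R ^ (α - 1) * R ^ (-α) := by
      rw [← Real.rpow_add hR, ← Real.rpow_add hR]; congr 1; ring
    rw [e1, e2]
    ring
  · filter_upwards [hden.eventually_gt_atTop 0] with R hR
    exact neg_ne_zero.2 (mul_pos (Real.exp_pos _) hR).ne'
  · have := intervalIntegral_tendsto_integral_Ioi 0 hi tendsto_id
    simpa using this.const_sub (∫ u in Set.Ioi 0, Real.exp (-b * u ^ α))
  · refine ((tendsto_rpow_mul_exp_neg_mul_atTop_nhds_zero (β / α) b hb).comp hpow).congr' ?_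
    filter_upwards [eventually_ge_atTop 0] with R hR
    simp only [Function.comp_apply]
    rw [← Real.rpow_mul hR, mul_div_cancel₀ _ hα.ne']
  · refine hden.inv_tendsto_atTop.congr fun R => ?_
    have := (Real.exp_pos (-b * R ^ α)).ne'
    simp only [Pi.inv_apply]
    rw [neg_div_neg_eq, div_mul_eq_div_div, div_self this, one_div]

/-- The tail bound needed for the bias: `exp (c R^α) R^{-β} ∫_R^∞ exp (-b u^α) du → 0`. -/
lemma tendsto_exp_mul_integral_Ioi_exp_neg {α b c β : ℝ} (hα : 0 < α) (hb : 0 < b) (hβ : 0 < β)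
    (h : c < b ∨ (c = b ∧ 1 - α < β)) :
    Tendsto (fun R : ℝ => Real.exp (c * R ^ α) / R ^ β *
      ∫ u in Set.Ioi R, Real.exp (-b * u ^ α)) atTop (𝓝 0) := by
  rcases h with h | ⟨rfl, h⟩
  · have hbc : 0 < b - c := sub_pos.2 h
    have hi {R : ℝ} (hR : 0 ≤ R) := integrableOn_Ioi_exp_neg_mul_rpow hα hb hR
    -- For `c < b` the factor `exp (c R^α)` can be absorbed into the integral, which stays bounded;
    -- the decay then comes from `R^(-β)`.
    have hlim : Tendsto (fun R : ℝ => (R ^ β)⁻¹ *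
        (∫ u in Set.Ioi 0, Real.exp (-(b - c) * u ^ α) + Real.exp (-b * u ^ α))) atTop (𝓝 0) := by
      simpa using (tendsto_rpow_atTop hβ).inv_tendsto_atTop.mul_const
        (∫ u in Set.Ioi 0, Real.exp (-(b - c) * u ^ α) + Real.exp (-b * u ^ α))
    refine squeeze_zero' ?_ ?_ hlim
    · filter_upwards [eventually_ge_atTop 0] with R hR
      exact mul_nonneg (div_nonneg (Real.exp_pos _).le (Real.rpow_nonneg hR _))
        (setIntegral_nonneg measurableSet_Ioi fun u _ => (Real.exp_pos _).le)
    · filter_upwards [eventually_gt_atTop 0] with R hR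
      have hi1 := integrableOn_Ioi_exp_neg_mul_rpow hα hbc le_rfl
      have hsum := hi1.add (hi le_rfl)
      rw [div_eq_mul_inv, mul_comm (Real.exp _), mul_assoc, ← integral_const_mul]
      refine mul_le_mul_of_nonneg_left ?_ (inv_nonneg.2 (Real.rpow_nonneg hR.le _))
      calc ∫ u in Set.Ioi R, Real.exp (c * R ^ α) * Real.exp (-b * u ^ α)
          ≤ ∫ u in Set.Ioi R, Real.exp (-(b - c) * u ^ α) + Real.exp (-b * u ^ α) := by
            refine setIntegral_mono_on ((hi hR.le).const_mul _)
              (hsum.mono_set (Set.Ioi_subset_Ioi hR.le)) measurableSet_Ioi fun u hu => ?_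
            have hpow : R ^ α ≤ u ^ α := Real.rpow_le_rpow hR.le (le_of_lt hu) hα.le
            rw [← Real.exp_add]
            -- For `c ≥ 0`, `c R^α ≤ c u^α` gives the first summand; for `c ≤ 0` the factor is at
            -- most `1` and the second summand suffices.
            rcases le_total 0 c with hc | hc
            · refine le_add_of_le_of_nonneg (Real.exp_le_exp.2 ?_) (Real.exp_pos _).le
              nlinarith
            · refine le_add_of_nonneg_of_le (Real.exp_pos _).le (Real.exp_le_exp.2 ?_)
              nlinarith [Real.rpow_nonneg hR.le α]
        _ ≤ _ := setIntegral_mono_set hsum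
            (.of_forall fun u => add_nonneg (Real.exp_pos _).le (Real.exp_pos _).le)
            (Set.Ioi_subset_Ioi hR.le).eventuallyLE
  · refine (tendsto_integral_Ioi_exp_neg_div hα hb h).congr fun R => ?_
    rw [neg_mul c (R ^ α), Real.exp_neg]
    field_simp

variable {d : ℕ} {p : EuclideanSpace ℝ (Fin d) → ℝ} {α K C₁ : ℝ}

lemma exp_neg_mul_sum (s : EuclideanSpace ℝ (Fin d)) :
    Real.exp (-C₁ * ∑ j, |s j| ^ α) = ∏ j, Real.exp (-C₁ * |s j| ^ α) := by
  rw [Finset.mul_sum, Real.exp_sum]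

/-- The bound is a product of one-dimensional integrable functions. Fourier inversion and the
variance limit both rest on this integrability. -/
lemma UpperSupersmoothWith.integrable_densityFourier (hα : 0 < α)
    (h : UpperSupersmoothWith p α K C₁) (hp : Integrable p) : Integrable (densityFourier p) := by
  have h1 : Integrable fun s : EuclideanSpace ℝ (Fin d) => K * Real.exp (-C₁ * ∑ j, |s j| ^ α) := by
    simp_rw [exp_neg_mul_sum]
    exact (integrable_euclidean_prod fun _ => integrable_exp_neg_mul_abs_rpow hα h.1).const_mul K
  exact h1.mono' (continuous_densityFourier hp).aestronglyMeasurable (.of_forall h.2)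

lemma UpperSupersmoothWith.const_nonneg (h : UpperSupersmoothWith p α K C₁) : 0 ≤ K :=
  nonneg_of_mul_nonneg_left ((norm_nonneg _).trans (h.2 0)) (Real.exp_pos _)

lemma integrable_inversionIntegrand (hp : Integrable p) (hp' : Integrable (densityFourier p))
    (x : EuclideanSpace ℝ (Fin d)) : Integrable (inversionIntegrand p x) :=
  hp'.mono (continuous_inversionIntegrand hp x).aestronglyMeasurable
    (.of_forall fun s => (norm_inversionIntegrand x s).le)

lemma integral_indicator_abs_ge {R : ℝ} (hR : 0 < R) :
    ∫ u : ℝ, {u : ℝ | R ≤ |u|}.indicator (fun u => Real.exp (-C₁ * |u| ^ α)) u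
      = 2 * ∫ u in Set.Ioi R, Real.exp (-C₁ * u ^ α) := by
  have h := integral_comp_abs (f := (Set.Ici R).indicator fun u => Real.exp (-C₁ * u ^ α))
  rw [setIntegral_indicator measurableSet_Ici,
    Set.inter_eq_right.2 (Set.Ici_subset_Ioi.2 hR), integral_Ici_eq_integral_Ioi] at h
  rw [← h]
  rfl

/-- A product of one-dimensional factors `e`, the `j`-th one cut off to `|u| ≥ R`. -/
lemma integral_prod_update_indicator {e : ℝ → ℝ} (R : ℝ) (j : Fin d) :
    ∫ s : EuclideanSpace ℝ (Fin d),
        ∏ k, (Function.update (fun _ => e) j ({u : ℝ | R ≤ |u|}.indicator e) : Fin d → ℝ → ℝ) k (s k)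
      = (∫ u, e u) ^ (d - 1) * ∫ u, {u : ℝ | R ≤ |u|}.indicator e u := by
  rw [integral_euclidean_prod, ← Finset.mul_prod_erase _ _ (Finset.mem_univ j),
    Finset.prod_congr rfl (g := fun _ => ∫ u, e u)]
  · rw [Finset.prod_const, Finset.card_erase_of_mem (Finset.mem_univ j), Finset.card_fin, mul_comm]
    simp only [Function.update_self]
  · intro k hk
    simp only [Function.update_of_ne (Finset.ne_of_mem_erase hk)]

/-- Outside a cube a product function has at most the mass of its one-dimensional tails. -/
lemma setIntegral_compl_openCube_prod_le {e : ℝ → ℝ} (he : Integrable e) (he0 : ∀ u, 0 ≤ e u)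
    (R : ℝ) :
    ∫ s in (openCube d R)ᶜ, ∏ k, e (s k)
      ≤ d * ((∫ u, e u) ^ (d - 1) * ∫ u, {u : ℝ | R ≤ |u|}.indicator e u) := by
  -- A union bound: a point outside the cube has some coordinate `j` with `|s j| ≥ R`, and `F j` is
  -- the product with only its `j`-th factor cut off to that region.
  obtain ⟨F, hF⟩ : ∃ F : Fin d → Fin d → ℝ → ℝ, ∀ j,
      F j = Function.update (fun _ => e) j ({u : ℝ | R ≤ |u|}.indicator e) := ⟨_, fun _ => rfl⟩
  have hms : MeasurableSet {u : ℝ | R ≤ |u|} := measurableSet_le (by fun_prop) (by fun_prop)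
  have hFj : ∀ j, F j j = {u : ℝ | R ≤ |u|}.indicator e := fun j => by
    rw [hF, Function.update_self]
  have hFk : ∀ j k, k ≠ j → F j k = e := fun j k hk => by
    rw [hF, Function.update_of_ne hk]
  have hFi : ∀ j k, Integrable (F j k) := fun j k => by
    by_cases hk : k = j
    · rw [hk, hFj]; exact he.indicator hms
    · rw [hFk j k hk]; exact he
  have hF0 : ∀ j k u, 0 ≤ F j k u := fun j k u => by
    by_cases hk : k = j
    · rw [hk, hFj]; exact Set.indicator_nonneg (fun u _ => he0 u) u
    · rw [hFk j k hk]; exact he0 u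
  have hprodi : ∀ j, Integrable fun s : EuclideanSpace ℝ (Fin d) => ∏ k, F j k (s k) := fun j =>
    integrable_euclidean_prod (hFi j)
  have hsum : Integrable fun s : EuclideanSpace ℝ (Fin d) => ∑ j, ∏ k, F j k (s k) :=
    integrable_finsetSum _ fun j _ => hprodi j
  have hnn : ∀ j (s : EuclideanSpace ℝ (Fin d)), 0 ≤ ∏ k, F j k (s k) := fun j s =>
    Finset.prod_nonneg fun k _ => hF0 j k _
  calc _ ≤ ∫ s in (openCube d R)ᶜ, ∑ j, ∏ k, F j k (s k) := by
        refine setIntegral_mono_on (integrable_euclidean_prod fun _ => he).integrableOn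
          hsum.integrableOn (measurableSet_openCube R).compl fun s hs => ?_
        obtain ⟨j, hj⟩ : ∃ j, ¬ |s j| < R := by simpa [openCube] using hs
        refine le_trans (le_of_eq (Finset.prod_congr rfl fun k _ => ?_)) (Finset.single_le_sum
          (f := fun j => ∏ k, F j k (s k)) (fun j _ => hnn j s) (Finset.mem_univ j))
        by_cases hk : k = j
        · rw [hk, hFj, Set.indicator_of_mem (show s j ∈ {u : ℝ | R ≤ |u|} from not_lt.1 hj)]
        · rw [hFk j k hk]
    _ ≤ ∫ s : EuclideanSpace ℝ (Fin d), ∑ j, ∏ k, F j k (s k) :=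
        setIntegral_le_integral hsum (.of_forall fun s => Finset.sum_nonneg fun j _ => hnn j s)
    _ = _ := by
        have hval : ∀ j, ∫ s : EuclideanSpace ℝ (Fin d), ∏ k, F j k (s k)
            = (∫ u, e u) ^ (d - 1) * ∫ u, {u : ℝ | R ≤ |u|}.indicator e u := fun j => by
          rw [hF]; exact integral_prod_update_indicator R j
        rw [integral_finsetSum _ fun j _ => hprodi j]
        simp only [hval, Finset.sum_const, Finset.card_fin, nsmul_eq_mul]

/-- The mass of the Fourier transform outside a cube is controlled by a one-dimensional tail. -/
lemma UpperSupersmoothWith.norm_setIntegral_compl_openCube_le (hα : 0 < α)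
    (h : UpperSupersmoothWith p α K C₁) (x : EuclideanSpace ℝ (Fin d)) {R : ℝ} (hR : 0 < R) :
    ‖∫ s in (openCube d R)ᶜ, inversionIntegrand p x s‖
      ≤ (K * (d * (∫ u : ℝ, Real.exp (-C₁ * |u| ^ α)) ^ (d - 1) * 2)) *
        ∫ u in Set.Ioi R, Real.exp (-C₁ * u ^ α) := by
  have he := integrable_exp_neg_mul_abs_rpow hα h.1
  have hi : Integrable fun s : EuclideanSpace ℝ (Fin d) =>
      K * ∏ k, Real.exp (-C₁ * |s k| ^ α) := (integrable_euclidean_prod fun _ => he).const_mul K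
  have h1 : ‖∫ s in (openCube d R)ᶜ, inversionIntegrand p x s‖
      ≤ ∫ s in (openCube d R)ᶜ, K * ∏ k, Real.exp (-C₁ * |s k| ^ α) := by
    refine norm_integral_le_of_norm_le hi.integrableOn (.of_forall fun s => ?_)
    rw [norm_inversionIntegrand, ← exp_neg_mul_sum]
    exact h.2 s
  have h2 := setIntegral_compl_openCube_prod_le (d := d) he (fun u => (Real.exp_pos _).le) R
  rw [integral_const_mul] at h1
  rw [integral_indicator_abs_ge hR] at h2
  calc _ ≤ _ := h1
    _ ≤ _ := mul_le_mul_of_nonneg_left h2 h.const_nonneg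
    _ = _ := by ring

/-! ### Fourier inversion in the angular-frequency normalisation. -/

lemma densityFourier_eq_fourier (s : EuclideanSpace ℝ (Fin d)) :
    densityFourier p (-(2 * Real.pi) • s) = FourierTransform.fourier (fun y => (p y : ℂ)) s := by
  rw [Real.fourier_eq', densityFourier]
  congr 1 with y
  rw [smul_eq_mul, mul_comm Complex.I]
  congr 4
  simp [PiLp.inner_apply, Finset.mul_sum]
  exact Finset.sum_congr rfl fun j _ => by ring

/-- Fourier inversion at a continuity point. -/
lemma integral_inversionIntegrand_of_continuousAt (hp : Integrable p)
    (hp' : Integrable (densityFourier p)) {x : EuclideanSpace ℝ (Fin d)} (hx : ContinuousAt p x) :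
    ∫ s, inversionIntegrand p x s = (2 * Real.pi) ^ d * (p x : ℂ) := by
  have h2 : -(2 * Real.pi) ≠ 0 := by simp [Real.pi_ne_zero]
  have hF : FourierTransform.fourier (fun y => (p y : ℂ))
      = fun s : EuclideanSpace ℝ (Fin d) => densityFourier p (-(2 * Real.pi) • s) :=
    funext fun s => (densityFourier_eq_fourier s).symm
  have hinv := hp.ofReal (𝕜 := ℂ) |>.fourierInv_fourier_eq (v := x)
    (by exact hF ▸ hp'.comp_smul h2) (Complex.continuous_ofReal.continuousAt.comp hx)
  have hcomp : FourierTransformInv.fourierInv (FourierTransform.fourier fun y => (p y : ℂ)) x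
      = ∫ s, inversionIntegrand p x (-(2 * Real.pi) • s) := by
    rw [Real.fourierInv_eq', hF]
    congr 1 with s
    rw [smul_eq_mul, inversionIntegrand]
    congr 4
    simp [PiLp.inner_apply, Finset.mul_sum]
    exact Finset.sum_congr rfl fun j _ => by ring
  have hinv' : ∫ s, inversionIntegrand p x (-(2 * Real.pi) • s) = (p x : ℂ) := hcomp ▸ hinv
  rw [← hinv', Measure.integral_comp_smul, finrank_euclideanSpace_fin, Complex.real_smul, abs_inv,
    abs_pow, abs_neg, abs_of_pos Real.two_pi_pos, ← mul_assoc]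
  push_cast
  rw [mul_inv_cancel₀, one_mul]
  exact pow_ne_zero _ (by simp [Real.pi_ne_zero])

/-- Dominated convergence with bound `‖p̂‖`. This carries the inversion formula from interior points
to boundary points. -/
lemma continuous_integral_inversionIntegrand (hp : Integrable p)
    (hp' : Integrable (densityFourier p)) :
    Continuous fun x => ∫ s, inversionIntegrand p x s := by
  refine continuous_of_dominated (bound := fun s => ‖densityFourier p s‖)
    (fun x => (continuous_inversionIntegrand hp x).aestronglyMeasurable)
    (fun x => .of_forall fun s => (norm_inversionIntegrand x s).le) hp'.norm
    (.of_forall fun s => ?_)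
  unfold inversionIntegrand
  fun_prop

/-- Fourier inversion on a set contained in the closure of its interior. -/
lemma integral_inversionIntegrand_eq (hp : Integrable p) (hp' : Integrable (densityFourier p))
    {A : Set (EuclideanSpace ℝ (Fin d))} (hA : A ⊆ closure (interior A)) (hc : ContinuousOn p A)
    {x : EuclideanSpace ℝ (Fin d)} (hx : x ∈ A) :
    ∫ s, inversionIntegrand p x s = (2 * Real.pi) ^ d * (p x : ℂ) := by
  -- `p` may be discontinuous at a boundary point `x`, but it is continuous within `A`: both sides
  -- of the formula converge along the interior, where they agree.
  have : (𝓝[interior A] x).NeBot := mem_closure_iff_nhdsWithin_neBot.1 (hA hx)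
  have h1 : Tendsto (fun y => ∫ s, inversionIntegrand p y s) (𝓝[interior A] x)
      (𝓝 (∫ s, inversionIntegrand p x s)) :=
    ((continuous_integral_inversionIntegrand hp hp').tendsto x).mono_left nhdsWithin_le_nhds
  have h2 : Tendsto (fun y => (2 * Real.pi : ℂ) ^ d * (p y : ℂ)) (𝓝[interior A] x)
      (𝓝 ((2 * Real.pi) ^ d * (p x : ℂ))) :=
    ((Complex.continuous_ofReal.tendsto _).comp
      ((hc x hx).mono_left (nhdsWithin_mono x interior_subset))).const_mul _
  refine tendsto_nhds_unique (h1.congr' ?_) h2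
  filter_upwards [self_mem_nhdsWithin] with y hy
  exact integral_inversionIntegrand_of_continuousAt hp hp'
    (hc.continuousAt (mem_interior_iff_mem_nhds.1 hy))

end

/-! ### Gaussian quantiles and interval coverage. -/

section

lemma gaussianReal_real_Ioi_eq {z τ : ℝ} (hz : cdf (gaussianReal 0 1) z = 1 - τ / 2) :
    (gaussianReal 0 1).real (Set.Ioi z) = τ / 2 := by
  have h := probReal_compl_eq_one_sub (μ := gaussianReal 0 1) (measurableSet_Iic (a := z))
  rw [← cdf_eq_real, hz, Set.compl_Iic] at h
  linarith

lemma gaussianReal_real_Iio_neg (z : ℝ) :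
    (gaussianReal 0 1).real (Set.Iio (-z)) = (gaussianReal 0 1).real (Set.Ioi z) := by
  have h : (gaussianReal 0 1).map (fun y => -y) = gaussianReal 0 1 := by
    rw [gaussianReal_map_neg, neg_zero]
  conv_lhs => rw [← h]
  rw [map_measureReal_apply measurable_neg measurableSet_Iio]
  congr 1
  ext y
  simp

/-- If `z < 0`, then `Iic z ⊆ Iio (-z)`, and by symmetry the latter has mass `τ / 2`. This forces `1
- τ / 2 ≤ τ / 2`, impossible for `τ < 1`. -/
lemma quantile_nonneg {z τ : ℝ} (hτ : τ < 1) (hz : cdf (gaussianReal 0 1) z = 1 - τ / 2) :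
    0 ≤ z := by
  by_contra! hneg
  have h1 : (gaussianReal 0 1).real (Set.Iic z) ≤ (gaussianReal 0 1).real (Set.Iio (-z)) :=
    measureReal_mono fun y (hy : y ≤ z) => by
      simp only [Set.mem_Iio]; linarith
  rw [gaussianReal_real_Iio_neg, gaussianReal_real_Ioi_eq hz, ← cdf_eq_real, hz] at h1
  linarith

lemma gaussianReal_real_Icc_quantile {z τ : ℝ} (hτ : τ < 1)
    (hz : cdf (gaussianReal 0 1) z = 1 - τ / 2) :
    (gaussianReal 0 1).real (Set.Icc (-z) z) = 1 - τ := by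
  have hz0 := quantile_nonneg hτ hz
  have hc : Set.Icc (-z) z = (Set.Iio (-z) ∪ Set.Ioi z)ᶜ := by
    ext y; simp
  rw [hc, probReal_compl_eq_one_sub (measurableSet_Iio.union measurableSet_Ioi),
    measureReal_union _ measurableSet_Ioi, gaussianReal_real_Iio_neg, gaussianReal_real_Ioi_eq hz]
  · ring
  · exact Set.disjoint_left.2 fun y (h1 : y < -z) (h2 : z < y) => by linarith

/-- The central interval of half-width `z √v` of `N(0, v)`. -/
lemma gaussianReal_real_abs_le {z τ v : ℝ} (hv : 0 < v) (hτ : τ < 1)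
    (hz : cdf (gaussianReal 0 1) z = 1 - τ / 2) :
    (gaussianReal 0 v.toNNReal).real {t | |t| - z * Real.sqrt v ≤ 0} = 1 - τ := by
  have hs : 0 < Real.sqrt v := Real.sqrt_pos.2 hv
  have hmap : (gaussianReal 0 1).map (fun y => Real.sqrt v * y) = gaussianReal 0 v.toNNReal := by
    rw [gaussianReal_map_const_mul, mul_zero, mul_one]
    congr 1
    ext
    simp [Real.sq_sqrt hv.le, hv.le]
  rw [← hmap, map_measureReal_apply (by fun_prop)
    (measurableSet_le (by fun_prop) (by fun_prop)), ← gaussianReal_real_Icc_quantile hτ hz]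
  congr 1
  ext y
  rw [Set.mem_preimage, Set.mem_ofPred_eq, Set.mem_Icc, abs_mul, abs_of_pos hs, sub_nonpos,
    mul_comm z, mul_le_mul_iff_right₀ hs, abs_le]

/-- Slutsky-type coverage: the studentised event has asymptotic probability `1 - τ`. -/
lemma tendsto_real_abs_le_of_tendstoInDistribution {Ω : Type*} [MeasurableSpace Ω] {P : Measure Ω}
    [IsProbabilityMeasure P] {T : ℕ → Ω → ℝ} {q w z τ : ℝ} (hq : 0 < q) (hw : 0 < w)
    (hT : TendstoInDistribution T atTop (id : ℝ → ℝ) (fun _ => P) (gaussianReal 0 (q / w).toNNReal))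
    {a : ℕ → ℝ} (ha : Tendsto a atTop (𝓝 0)) (hτ : τ < 1)
    (hz : cdf (gaussianReal 0 1) z = 1 - τ / 2) :
    Tendsto (fun n => P.real
      {ω | |T n ω| - z * Real.sqrt (max (q + a n * T n ω) 0 / w) ≤ 0}) atTop (𝓝 (1 - τ)) := by
  have hv : 0 < q / w := div_pos hq hw
  have hv' : (q / w).toNNReal ≠ 0 := by simpa using hv
  -- Coverage is the event `h (T n, a n) ≤ 0` with `h` continuous, so Slutsky yields the limit law
  -- of `h (T n, a n)`.
  set h : ℝ × ℝ → ℝ := fun y => |y.1| - z * Real.sqrt (max (q + y.2 * y.1) 0 / w) with hh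
  have hcont : Continuous h := by fun_prop
  have haP : TendstoInMeasure P (fun n (_ : Ω) => a n) atTop fun _ => (0 : ℝ) :=
    tendstoInMeasure_of_tendsto_ae (fun n => by fun_prop) (.of_forall fun _ => ha)
  have hW := hT.continuous_comp_prodMk_of_tendstoInMeasure_const hcont haP (fun n => by fun_prop)
  have hZ : ∀ t : ℝ, h (id t, 0) = |t| - z * Real.sqrt (q / w) := fun t => by
    simp only [hh, id, zero_mul, add_zero, max_eq_left hq.le]
  have hmZ : Measurable fun t : ℝ => h (id t, 0) := hcont.measurable.comp (by fun_prop)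
  have hmain := ProbabilityMeasure.tendsto_measure_of_null_frontier_of_tendsto' hW.tendsto
    (E := Set.Iic 0) (by
      rw [frontier_Iic, ProbabilityMeasure.coe_mk, Measure.map_apply hmZ (measurableSet_singleton 0)]
      -- The boundary event is `|t| = z √(q / w)`, at most two points, which are null since the
      -- limit variance is positive.
      refine measure_mono_null (t := {z * Real.sqrt (q / w), -(z * Real.sqrt (q / w))})
        (fun t ht => ?_) ?_
      · have : |t| = z * Real.sqrt (q / w) := by
          have : h (id t, 0) = 0 := ht
          rw [hZ] at this
          linarith
        rcases le_total 0 t with h0 | h0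
        · left; rwa [abs_of_nonneg h0] at this
        · right; rw [abs_of_nonpos h0] at this
          simp only [Set.mem_singleton_iff]; linarith
      · have := nullSingletonClass_gaussianReal (μ := 0) hv'
        exact (Set.toFinite _).measure_zero _)
  rw [ProbabilityMeasure.coe_mk, Measure.map_apply hmZ measurableSet_Iic] at hmain
  have hlim := (ENNReal.tendsto_toReal (measure_ne_top _ _)).comp hmain
  have hval : ((gaussianReal 0 (q / w).toNNReal)
      ((fun t : ℝ => h (id t, 0)) ⁻¹' Set.Iic 0)).toReal = 1 - τ := by
    rw [← gaussianReal_real_abs_le hv hτ hz, measureReal_def]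
    congr 2
    ext t
    simp only [Set.mem_preimage, Set.mem_Iic, hZ, Set.mem_ofPred_eq]
  rw [hval] at hlim
  refine hlim.congr fun n => ?_
  simp only [Function.comp_apply, ProbabilityMeasure.coe_mk]
  rw [Measure.map_apply_of_aemeasurable (hW.forall_aemeasurable n) measurableSet_Iic]
  rfl

/-- The density value lies in the interval iff the normalised error is small. -/
lemma mem_fourierInterval_iff {d n : ℕ} {R z m q v : ℝ} (hn : 0 < n) (hR : 0 < R) (hv : 0 ≤ v) :
    q ∈ fourierInterval d n R z m v ↔
      |Real.sqrt (n / R ^ d) * (m - q)| - z * Real.sqrt (v / Real.pi ^ d) ≤ 0 := by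
  have hn' : (0 : ℝ) < n := by exact_mod_cast hn
  have hr : 0 < (n : ℝ) / R ^ d := div_pos hn' (pow_pos hR d)
  have hs : 0 < Real.sqrt (n / R ^ d) := Real.sqrt_pos.2 hr
  have e : Real.sqrt (R ^ d * v / (n * Real.pi ^ d))
      = Real.sqrt (v / Real.pi ^ d) / Real.sqrt (n / R ^ d) := by
    rw [← Real.sqrt_div (by positivity)]
    congr 1
    field_simp
  rw [fourierInterval, e, abs_mul, abs_of_pos hs, sub_nonpos, ← le_div_iff₀' hs,
    ← mul_div_assoc, Set.mem_Icc, abs_le]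
  constructor <;> rintro ⟨h1, h2⟩ <;> constructor <;> linarith

/-! ### Growth of the radius and of the normalising factor. -/

lemma tendsto_radius {α C : ℝ} (hα : 0 < α) (hC : 0 < C) {R : ℕ → ℝ}
    (hR : ∀ n : ℕ, 2 ≤ n → 0 < R n ∧ R n ^ α = C * Real.log n) : Tendsto R atTop atTop := by
  have h1 : Tendsto (fun n : ℕ => (C * Real.log n) ^ (1 / α)) atTop atTop :=
    (tendsto_rpow_atTop (by positivity)).comp
      ((Real.tendsto_log_atTop.comp tendsto_natCast_atTop_atTop).const_mul_atTop hC)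
  refine h1.congr' ?_
  filter_upwards [eventually_ge_atTop 2] with n hn
  obtain ⟨h0, h⟩ := hR n hn
  rw [← h, ← Real.rpow_mul h0.le, mul_one_div_cancel hα.ne', Real.rpow_one]

/-- Here `√n = exp (log n / 2)` and `log n = R^α / C`, which puts the normalisation on the same
exponential scale as the bias. -/
lemma sqrt_natCast_div_pow_eq {d n : ℕ} {α C R : ℝ} (hC : 0 < C) (hn : 0 < n) (h0 : 0 < R)
    (h : R ^ α = C * Real.log n) :
    Real.sqrt (n / R ^ d) = Real.exp (1 / (2 * C) * R ^ α) / R ^ ((d : ℝ) / 2) := by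
  have hn' : (0 : ℝ) < n := by exact_mod_cast hn
  rw [Real.sqrt_div hn'.le]
  congr 1
  · rw [h, Real.sqrt_eq_rpow, Real.rpow_def_of_pos hn']
    congr 1
    field_simp
  · rw [Real.sqrt_eq_rpow, ← Real.rpow_natCast, ← Real.rpow_mul h0.le]
    congr 1
    ring

/-- This rate serves twice: for the negligibility of the summands and for the plug-in variance. -/
lemma tendsto_inv_sqrt_natCast_div_pow {d : ℕ} {α C : ℝ} (hα : 0 < α) (hC : 0 < C) {R : ℕ → ℝ}
    (hR : ∀ n : ℕ, 2 ≤ n → 0 < R n ∧ R n ^ α = C * Real.log n) :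
    Tendsto (fun n : ℕ => (Real.sqrt (n / R n ^ d))⁻¹) atTop (𝓝 0) := by
  have h1 := ((tendsto_rpow_mul_exp_neg_mul_atTop_nhds_zero ((d : ℝ) / 2 / α) (1 / (2 * C))
    (by positivity)).comp (tendsto_rpow_atTop hα)).comp (tendsto_radius hα hC hR)
  refine h1.congr' ?_
  filter_upwards [eventually_ge_atTop 2] with n hn
  obtain ⟨h0, h⟩ := hR n hn
  rw [sqrt_natCast_div_pow_eq hC (by omega) h0 h]
  simp only [Function.comp_apply]
  rw [← Real.rpow_mul h0.le, mul_div_cancel₀ _ hα.ne', neg_mul, Real.exp_neg, inv_div,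
    div_eq_mul_inv (R n ^ ((d : ℝ) / 2))]

/-! ### Bias, variance and asymptotic normality of the estimator. -/

variable {d : ℕ} {p : EuclideanSpace ℝ (Fin d) → ℝ} {α K C₁ : ℝ}

lemma IsProbDensity.integral_withDensity (hp : IsProbDensity p)
    (g : EuclideanSpace ℝ (Fin d) → ℝ) :
    ∫ y, g y ∂(volume.withDensity fun y => ENNReal.ofReal (p y)) = ∫ y, g y * p y := by
  rw [integral_withDensity_eq_integral_toReal_smul (by have := hp.measurable; fun_prop)
    (.of_forall fun _ => ENNReal.ofReal_lt_top)]
  congr 1 with y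
  rw [ENNReal.toReal_ofReal (hp.nonneg y), smul_eq_mul, mul_comm]

/-- The bias of the Fourier density estimator as a tail of the inversion integral. -/
lemma norm_mean_sub_eq (hp : Integrable p) (hp' : Integrable (densityFourier p))
    {x : EuclideanSpace ℝ (Fin d)}
    (hx : ∫ s, inversionIntegrand p x s = (2 * Real.pi) ^ d * (p x : ℂ)) {R : ℝ} (hR : 0 < R) :
    |(∫ y, (∏ j, fourierKernel R (x j - y j)) * p y) / Real.pi ^ d - p x|
      = ((2 * Real.pi) ^ d)⁻¹ * ‖∫ s in (openCube d R)ᶜ, inversionIntegrand p x s‖ := by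
  have h1 := integral_prod_fourierKernel_mul hp hR x
  have h2 := integral_add_compl (measurableSet_openCube R) (integrable_inversionIntegrand hp hp' x)
  rw [hx] at h2
  have hpi : (Real.pi : ℂ) ≠ 0 := by simp [Real.pi_ne_zero]
  have h3 : (((∫ y, (∏ j, fourierKernel R (x j - y j)) * p y) / Real.pi ^ d - p x : ℝ) : ℂ)
      = -(((2 * Real.pi) ^ d)⁻¹ * ∫ s in (openCube d R)ᶜ, inversionIntegrand p x s) := by
    rw [Complex.ofReal_sub, Complex.ofReal_div, h1, eq_sub_of_add_eq h2]
    push_cast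
    rw [mul_pow, div_pow, one_pow]
    field_simp
    ring
  rw [← Real.norm_eq_abs, ← Complex.norm_real, h3, norm_neg, norm_mul]
  congr 1
  rw [Complex.norm_real, Real.norm_eq_abs, abs_of_nonneg (by positivity)]

/-- The scaled bias vanishes. -/
lemma tendsto_sqrt_mul_bias (hd : 0 < d) (hp : Integrable p) (hα : 0 < α)
    (hs : UpperSupersmoothWith p α K C₁) {x : EuclideanSpace ℝ (Fin d)}
    (hx : ∫ s, inversionIntegrand p x s = (2 * Real.pi) ^ d * (p x : ℂ)) {C : ℝ} (hC0 : 0 < C)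
    (hC : 1 / (2 * C₁) < C ∨ (C = 1 / (2 * C₁) ∧ 1 - α < (d : ℝ) / 2)) {R : ℕ → ℝ}
    (hR : ∀ n : ℕ, 2 ≤ n → 0 < R n ∧ R n ^ α = C * Real.log n) :
    Tendsto (fun n : ℕ => Real.sqrt (n / R n ^ d) *
      ((∫ y, (∏ j, fourierKernel (R n) (x j - y j)) * p y) / Real.pi ^ d - p x)) atTop (𝓝 0) := by
  have hC₁ := hs.1
  have hd' : (0 : ℝ) < (d : ℝ) / 2 := by positivity
  -- The condition on `C` is inverted into one on the growth exponent `1 / (2C)` of `√n`, compared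
  -- with the decay rate `C₁`.
  have hc : 1 / (2 * C) < C₁ ∨ (1 / (2 * C) = C₁ ∧ 1 - α < (d : ℝ) / 2) := by
    rcases hC with h | ⟨h, h'⟩
    · left
      rw [div_lt_iff₀ (by positivity)] at h ⊢
      linarith
    · right
      refine ⟨?_, h'⟩
      rw [h]; field_simp
  set M := K * (d * (∫ u : ℝ, Real.exp (-C₁ * |u| ^ α)) ^ (d - 1) * 2) with hM
  have hlim := ((tendsto_exp_mul_integral_Ioi_exp_neg hα hC₁ hd' hc).comp
    (tendsto_radius hα hC0 hR)).const_mul (((2 * Real.pi) ^ d)⁻¹ * M)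
  rw [mul_zero] at hlim
  refine squeeze_zero_norm' ?_ hlim
  filter_upwards [eventually_ge_atTop 2] with n hn
  obtain ⟨h0, h⟩ := hR n hn
  have hb := hs.norm_setIntegral_compl_openCube_le hα x h0
  rw [← hM] at hb
  rw [norm_mul, Real.norm_eq_abs, Real.norm_eq_abs,
    norm_mean_sub_eq hp (hs.integrable_densityFourier hα hp) hx h0,
    abs_of_nonneg (Real.sqrt_nonneg _), sqrt_natCast_div_pow_eq hC0 (by omega) h0 h]
  simp only [Function.comp_apply]
  calc _ ≤ Real.exp (1 / (2 * C) * R n ^ α) / R n ^ ((d : ℝ) / 2) * (((2 * Real.pi) ^ d)⁻¹ *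
        (M * ∫ u in Set.Ioi (R n), Real.exp (-C₁ * u ^ α))) := by gcongr
    _ = _ := by ring

/-- The normalised second moment of the product kernel converges to `π^d p(x)`. -/
lemma tendsto_second_moment (hp : Integrable p) (hp' : Integrable (densityFourier p))
    {x : EuclideanSpace ℝ (Fin d)}
    (hx : ∫ s, inversionIntegrand p x s = (2 * Real.pi) ^ d * (p x : ℂ)) :
    Tendsto (fun R : ℝ => (R ^ d)⁻¹ * ∫ y, (∏ j, fourierKernel R (x j - y j)) ^ 2 * p y) atTop
      (𝓝 (Real.pi ^ d * p x)) := by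
  have h1 := (tendsto_integral_openCube_add (integrable_inversionIntegrand hp hp' x)
    (continuous_inversionIntegrand hp x).measurable).const_mul ((1 / 4 : ℂ) ^ d)
  rw [hx] at h1
  have h2 := (Complex.continuous_re.tendsto _).comp h1
  -- The constants combine as `(1/4 · 2 · 2π)^d = π^d`.
  have e : ((1 / 4 : ℂ) ^ d * (2 ^ d * ((2 * Real.pi) ^ d * (p x : ℂ))))
      = ((Real.pi ^ d * p x : ℝ) : ℂ) := by
    push_cast
    rw [← mul_assoc, ← mul_assoc, ← mul_pow, ← mul_pow]
    congr 2
    ring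
  rw [e, Complex.ofReal_re] at h2
  refine h2.congr' ?_
  filter_upwards [eventually_gt_atTop 0] with R hR
  simp only [Function.comp_apply]
  rw [← Complex.ofReal_re ((R ^ d)⁻¹ * _), Complex.ofReal_mul,
    integral_prod_fourierKernel_sq_mul hp hR, Complex.ofReal_inv]
  congr 1
  ring

/-- The mean of the product kernel is bounded uniformly in the radius. -/
lemma abs_mean_le (hp : Integrable p) (hp' : Integrable (densityFourier p))
    (x : EuclideanSpace ℝ (Fin d)) {R : ℝ} (hR : 0 < R) :
    |∫ y, (∏ j, fourierKernel R (x j - y j)) * p y| ≤ ∫ s, ‖inversionIntegrand p x s‖ := by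
  have hi := integrable_inversionIntegrand hp hp' x
  rw [← Real.norm_eq_abs, ← Complex.norm_real, integral_prod_fourierKernel_mul hp hR, norm_mul]
  have h1 : ‖((1 / 2 : ℂ)) ^ d‖ ≤ 1 := by
    rw [norm_pow]
    exact pow_le_one₀ (norm_nonneg _) (by norm_num)
  calc _ ≤ 1 * ‖∫ s in openCube d R, inversionIntegrand p x s‖ := by gcongr
    _ ≤ _ := by
      rw [one_mul]
      exact (norm_integral_le_integral_norm _).trans
        (setIntegral_le_integral hi.norm (.of_forall fun _ => norm_nonneg _))

/-- Asymptotic normality of the Fourier density estimator at a point of Fourier inversion. -/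
theorem tendstoInDistribution_fourierEstimator (hd : 0 < d) (hp : IsProbDensity p) (hα : 0 < α)
    (hs : UpperSupersmoothWith p α K C₁) {Ω : Type*} [MeasurableSpace Ω] {P : Measure Ω}
    [IsProbabilityMeasure P] {X : ℕ → Ω → EuclideanSpace ℝ (Fin d)} (hX : ∀ i, Measurable (X i))
    (hindep : iIndepFun X P)
    (hlaw : ∀ i, P.map (X i) = volume.withDensity (fun x => ENNReal.ofReal (p x)))
    {x : EuclideanSpace ℝ (Fin d)}
    (hx : ∫ s, inversionIntegrand p x s = (2 * Real.pi) ^ d * (p x : ℂ)) {C : ℝ} (hC0 : 0 < C)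
    (hC : 1 / (2 * C₁) < C ∨ (C = 1 / (2 * C₁) ∧ 1 - α < (d : ℝ) / 2)) {R : ℕ → ℝ}
    (hR : ∀ n : ℕ, 2 ≤ n → 0 < R n ∧ R n ^ α = C * Real.log n) :
    TendstoInDistribution
      (fun (n : ℕ) (ω : Ω) =>
        Real.sqrt ((n : ℝ) / R n ^ d) * (fourierEstimator X n (R n) x ω - p x))
      atTop (id : ℝ → ℝ) (fun _ => P) (gaussianReal 0 (p x / Real.pi ^ d).toNNReal) := by
  set μ : Measure (EuclideanSpace ℝ (Fin d)) :=
    volume.withDensity (fun x => ENNReal.ofReal (p x)) with hμ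
  have hμP : IsProbabilityMeasure μ := hlaw 0 ▸ Measure.isProbabilityMeasure_map (hX 0).aemeasurable
  have hp' := hs.integrable_densityFourier hα hp.integrable
  have hRlim := tendsto_radius hα hC0 hR
  have hpi : 0 < Real.pi ^ d := pow_pos Real.pi_pos d
  set k : ℕ → EuclideanSpace ℝ (Fin d) → ℝ := fun n y => ∏ j, fourierKernel (R n) (x j - y j)
    with hk
  set m : ℕ → ℝ := fun n => ∫ y, k n y * p y with hm
  set r : ℕ → ℝ := fun n => (Real.pi ^ d * Real.sqrt (R n ^ d))⁻¹ with hr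
  have hr0 : ∀ n, 0 ≤ r n := fun n => inv_nonneg.2 (mul_nonneg hpi.le (Real.sqrt_nonneg _))
  have hkb : ∀ n y, |k n y| ≤ |R n| ^ d := fun n y => abs_prod_fourierKernel_le _ _
  have hkm : ∀ n, Measurable (k n) := fun n => measurable_prod_fourierKernel _ _
  have hki : ∀ n, Integrable (k n) μ := fun n =>
    Integrable.of_bound (hkm n).aestronglyMeasurable _ (.of_forall (hkb n))
  have hk2i : ∀ n, Integrable (fun y => k n y ^ 2) μ := fun n =>
    Integrable.of_bound ((hkm n).pow_const 2).aestronglyMeasurable ((|R n| ^ d) ^ 2)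
      (.of_forall fun y => by
        rw [Real.norm_eq_abs, abs_pow]; exact pow_le_pow_left₀ (abs_nonneg _) (hkb n y) 2)
  have hmμ : ∀ n, ∫ y, k n y ∂μ = m n := fun n => hp.integral_withDensity _
  have hmb : ∀ n, |m n| ≤ |R n| ^ d := fun n => by
    rw [← hmμ, ← Real.norm_eq_abs]
    simpa using norm_integral_le_of_norm_le_const (μ := μ) (f := k n) (.of_forall (hkb n))
  -- The factor `r n` is chosen so that `(√n)⁻¹ ∑ f n (X i)` is the normalised deviation of the
  -- estimator from its mean; `b n` is the normalised bias.
  set f : ℕ → EuclideanSpace ℝ (Fin d) → ℝ := fun n y => (k n y - m n) * r n with hf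
  set b : ℕ → ℝ := fun n => Real.sqrt (n / R n ^ d) * (m n / Real.pi ^ d - p x) with hb
  have hb0 : Tendsto b atTop (𝓝 0) :=
    tendsto_sqrt_mul_bias hd hp.integrable hα hs hx hC0 hC hR
  have hfB : ∀ n y, |f n y| ≤ 2 * |R n| ^ d * r n := fun n y => by
    rw [hf]; simp only [abs_mul, abs_of_nonneg (hr0 n)]
    refine mul_le_mul_of_nonneg_right ?_ (hr0 n)
    linarith [abs_sub (k n y) (m n), hkb n y, hmb n]
  have hB0 : Tendsto (fun n : ℕ => 2 * |R n| ^ d * r n / Real.sqrt n) atTop (𝓝 0) := by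
    have h1 := (tendsto_inv_sqrt_natCast_div_pow (d := d) hα hC0 hR).const_mul (2 / Real.pi ^ d)
    rw [mul_zero] at h1
    refine h1.congr' ?_
    filter_upwards [eventually_ge_atTop 2] with n hn
    have h0 := (hR n hn).1
    have hRd : 0 < R n ^ d := pow_pos h0 d
    have hsq : 0 < Real.sqrt (R n ^ d) := Real.sqrt_pos.2 hRd
    rw [abs_of_pos h0, hr, Real.sqrt_div n.cast_nonneg, inv_div]
    simp only
    nth_rewrite 2 [← Real.sq_sqrt hRd.le]
    field_simp
  have hf0 : ∀ n, ∫ y, f n y ∂μ = 0 := fun n => by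
    rw [hf, integral_mul_const, integral_sub (hki n) (integrable_const _), hmμ]
    simp
  have hf2 : ∀ n, ∫ y, f n y ^ 2 ∂μ = ((∫ y, k n y ^ 2 * p y) - m n ^ 2) * r n ^ 2 := fun n => by
    have e : ∀ y, f n y ^ 2 = (k n y ^ 2 - 2 * m n * k n y + m n ^ 2) * r n ^ 2 := fun y => by
      rw [hf]; ring
    simp_rw [e]
    have i1 : Integrable (fun y => 2 * m n * k n y) μ := (hki n).const_mul _
    have i2 : Integrable (fun y => k n y ^ 2 - 2 * m n * k n y) μ := (hk2i n).sub i1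
    rw [integral_mul_const, integral_add i2 (integrable_const _), integral_sub (hk2i n) i1,
      integral_const_mul, hmμ, hp.integral_withDensity]
    simp
    left
    ring
  have hvar : Tendsto (fun n => ∫ y, f n y ^ 2 ∂μ) atTop (𝓝 (p x / Real.pi ^ d)) := by
    have h1 := (tendsto_second_moment hp.integrable hp' hx).comp hRlim
    have h2 : Tendsto (fun n => m n ^ 2 * (R n ^ d)⁻¹) atTop (𝓝 0) := by
      have hinv : Tendsto (fun n => (R n ^ d)⁻¹) atTop (𝓝 0) :=
        ((tendsto_pow_atTop hd.ne').comp hRlim).inv_tendsto_atTop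
      have h3 := hinv.const_mul ((∫ s, ‖inversionIntegrand p x s‖) ^ 2)
      rw [mul_zero] at h3
      refine squeeze_zero' ?_ ?_ h3
      · filter_upwards [eventually_ge_atTop 2] with n hn
        have := (hR n hn).1
        positivity
      · filter_upwards [eventually_ge_atTop 2] with n hn
        have h0 := (hR n hn).1
        have := abs_mean_le hp.integrable hp' x h0
        refine mul_le_mul_of_nonneg_right ?_ (by positivity)
        rw [← sq_abs]
        exact pow_le_pow_left₀ (abs_nonneg _) this 2
    have h4 := (h1.sub h2).mul_const ((Real.pi ^ d) ^ 2)⁻¹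
    have e : (Real.pi ^ d * p x - 0) * ((Real.pi ^ d) ^ 2)⁻¹ = p x / Real.pi ^ d := by
      field_simp; ring
    rw [e] at h4
    refine h4.congr' ?_
    filter_upwards [eventually_ge_atTop 2] with n hn
    have h0 := (hR n hn).1
    rw [hf2, hr]
    simp only [Function.comp_apply, inv_pow, mul_pow, Real.sq_sqrt (pow_pos h0 d).le]
    rw [mul_inv]
    ring
  have hCLT := tendstoInDistribution_inv_sqrt_mul_sum_triangular hX hindep hlaw
    (fun n => ((hkm n).sub_const _).mul_const _) hfB hB0 hf0
    (div_nonneg (hp.nonneg x) hpi.le) hvar hb0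
  refine hCLT.congr (fun n => .of_forall fun ω => ?_) (.of_forall fun _ => rfl)
  -- The identity is needed for every `n`; at `n = 0` both sides are `0` by the conventions for
  -- division and square root.
  rcases Nat.eq_zero_or_pos n with rfl | hn
  · simp [hb]
  have hn' : (0 : ℝ) < n := by exact_mod_cast hn
  have hsn : Real.sqrt n ≠ 0 := (Real.sqrt_pos.2 hn').ne'
  have hnn : (n : ℝ) = Real.sqrt n ^ 2 := (Real.sq_sqrt hn'.le).symm
  simp only [hb, hr, fourierEstimator]
  rw [← Finset.sum_mul, Finset.sum_sub_distrib, Finset.sum_const, Finset.card_range, nsmul_eq_mul,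
    Real.sqrt_div hn'.le]
  simp only [hk, div_eq_mul_inv, mul_inv, one_mul]
  have hn1 : (n : ℝ)⁻¹ = (Real.sqrt n)⁻¹ * (Real.sqrt n)⁻¹ := by
    rw [← mul_inv, Real.mul_self_sqrt hn'.le]
  have hc1 : (Real.sqrt n)⁻¹ * (n : ℝ) = Real.sqrt n := by
    rw [inv_mul_eq_div, Real.div_sqrt]
  have hc2 : Real.sqrt n * (n : ℝ)⁻¹ = (Real.sqrt n)⁻¹ := by
    rw [hn1, ← mul_assoc, mul_inv_cancel₀ hsn, one_mul]
  linear_combination (-m n * (Real.pi ^ d)⁻¹ * (Real.sqrt (R n ^ d))⁻¹) * hc1 -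
    ((∑ i ∈ Finset.range n, ∏ j, fourierKernel (R n) (x j - X i ω j)) *
      (Real.pi ^ d)⁻¹ * (Real.sqrt (R n ^ d))⁻¹) * hc2

end

theorem proposition2 {d : ℕ} (hd : 0 < d)
    (p₀ : EuclideanSpace ℝ (Fin d) → ℝ) (hp₀ : IsProbDensity p₀)
    (α K C₁ : ℝ) (hα : 0 < α) (hsmooth : UpperSupersmoothWith p₀ α K C₁)
    (𝒳 : Set (EuclideanSpace ℝ (Fin d))) (h𝒳 : Bornology.IsBounded 𝒳)
    (h𝒳reg : 𝒳 ⊆ closure (interior 𝒳)) (hC1 : ContDiffOn ℝ 1 p₀ 𝒳)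
    {Ω : Type*} [MeasurableSpace Ω] (P : Measure Ω) [IsProbabilityMeasure P]
    (X : ℕ → Ω → EuclideanSpace ℝ (Fin d)) (hX : ∀ i, Measurable (X i))
    (hindep : iIndepFun X P)
    (hlaw : ∀ i, P.map (X i) = volume.withDensity (fun x => ENNReal.ofReal (p₀ x)))
    (C : ℝ) (hC : 1 / (2 * C₁) < C ∨ (C = 1 / (2 * C₁) ∧ 1 - α < (d : ℝ) / 2))
    (R : ℕ → ℝ) (hR : ∀ n : ℕ, 2 ≤ n → 0 < R n ∧ R n ^ α = C * Real.log n)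
    (x : EuclideanSpace ℝ (Fin d)) (hx : x ∈ 𝒳) :
    TendstoInDistribution
      (fun (n : ℕ) (ω : Ω) =>
        Real.sqrt ((n : ℝ) / R n ^ d) * (fourierEstimator X n (R n) x ω - p₀ x))
      atTop (id : ℝ → ℝ) (fun _ => P)
      (gaussianReal 0 (p₀ x / Real.pi ^ d).toNNReal) ∧
    (0 < p₀ x → ∀ τ : ℝ, 0 < τ → τ < 1 →
      ∀ z : ℝ, cdf (gaussianReal 0 1) z = 1 - τ / 2 →
        Tendsto (fun n : ℕ => P.real {ω | p₀ x ∈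
            fourierInterval d n (R n) z (fourierEstimator X n (R n) x ω) (p₀ x)})
          atTop (𝓝 (1 - τ)) ∧
        Tendsto (fun n : ℕ => P.real {ω | p₀ x ∈
            fourierInterval d n (R n) z (fourierEstimator X n (R n) x ω)
              (max (fourierEstimator X n (R n) x ω) 0)})
          atTop (𝓝 (1 - τ))) := by
  have hC₁ := hsmooth.1
  have hC0 : 0 < C := by
    have h : 0 < 1 / (2 * C₁) := by positivity
    rcases hC with hC | ⟨hC, -⟩ <;> linarith
  have hpi : 0 < Real.pi ^ d := pow_pos Real.pi_pos d
  have hinv := integral_inversionIntegrand_eq hp₀.integrable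
    (hsmooth.integrable_densityFourier hα hp₀.integrable) h𝒳reg hC1.continuousOn hx
  have hclt := tendstoInDistribution_fourierEstimator hd hp₀ hα hsmooth hX hindep hlaw hinv hC0 hC hR
  refine ⟨hclt, fun hpx τ _ hτ1 z hz => ⟨?_, ?_⟩⟩
  · refine (tendsto_real_abs_le_of_tendstoInDistribution hpx hpi hclt
      (a := fun _ => 0) tendsto_const_nhds hτ1 hz).congr' ?_
    filter_upwards [eventually_ge_atTop 2] with n hn
    congr 1
    ext ω
    rw [Set.mem_ofPred_eq, Set.mem_ofPred_eq,
      mem_fourierInterval_iff (by omega) (hR n hn).1 hpx.le, zero_mul, add_zero,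
      max_eq_left hpx.le]
  -- With `a n = (√(n / R^d))⁻¹`, the quantity `p₀ x + a n * T n` is exactly the estimator, so its
  -- positive part is the plug-in value.
  · refine (tendsto_real_abs_le_of_tendstoInDistribution hpx hpi hclt
      (tendsto_inv_sqrt_natCast_div_pow (d := d) hα hC0 hR) hτ1 hz).congr' ?_
    filter_upwards [eventually_ge_atTop 2] with n hn
    have h0 := (hR n hn).1
    have hs : Real.sqrt ((n : ℝ) / R n ^ d) ≠ 0 := by
      have : (0 : ℝ) < n := by exact_mod_cast (by omega : 0 < n)
      exact (Real.sqrt_pos.2 (div_pos this (pow_pos h0 d))).ne'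
    congr 1
    ext ω
    rw [Set.mem_ofPred_eq, Set.mem_ofPred_eq,
      mem_fourierInterval_iff (by omega) h0 (le_max_right _ _), inv_mul_cancel_left₀ hs,
      add_sub_cancel]
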